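/- Let $\mathbf{O}$ be the octonions with conjugation $\overline{x}$ and inner product $(x|y)=\mathrm{Re}(x\overline{y})$. Let $\mathcal{J}^1$ be the real vector space of the matrices $$h^1(\xi_1,\xi_2,\xi_3;x_1,x_2,x_3)=\begin{pmatrix}\xi_1&\sqrt{-1}\,x_3&\sqrt{-1}\,\overline{x_2}\\ \sqrt{-1}\,\overline{x_3}&\xi_2&x_1\\ \sqrt{-1}\,x_2&\overline{x_1}&\xi_3\end{pmatrix}\qquad(\xi_i\in\mathbb{R},\ x_i\in\mathbf{O})$$ over $\mathbf{O}\otimes\mathbb{C}$, with Jordan product $X\circ Y=\frac12(XY+YX)$, trace $\mathrm{tr}(X)=\xi_1+\xi_2+\xi_3$, inner product $(X|Y)=\mathrm{tr}(X\circ Y)$, unit $E=h^1(1,1,1;0,0,0)$ and cross product $X\times Y=\frac12\bigl(2X\circ Y-\mathrm{tr}(X)Y-\mathrm{tr}(Y)X+(\mathrm{tr}(X)\mathrm{tr}(Y)-(X|Y))E\bigr)$. Put $E_1=h^1(1,0,0;0,0,0)$, $E_2=h^1(0,1,0;0,0,0)$, $P^-_{12}=h^1(-1,1,0;0,0,1)$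 and $P^-_{13}=h^1(-1,0,1;0,1,0)$. Let $G=\mathrm{F}_{4(-20)}=\{g\in \mathrm{GL}_{\mathbb{R}}(\mathcal{J}^1)\mid g(X\circ Y)=gX\circ gY \text{ for all } X,Y\in\mathcal{J}^1\}$, with Lie algebra $\mathfrak{g}$. Let $\sigma\in G$ be the element that fixes $\xi_1,\xi_2,\xi_3,x_1$ and changes the signs of $x_2,x_3$; let $K=\{g\in G\mid \sigma g\sigma^{-1}=g\}$, and let $\theta(X)=\sigma X\sigma^{-1}$ be the corresponding Cartan involution of $\mathfrak{g}$, with $\mathfrak{k}=\{X\in\mathfrak{g}\mid\theta(X)=X\}$. Let $\mathfrak{a}=\mathbb{R}H_0\subset\mathfrak{g}$, where $H_0$ is the derivation $$H_0\,h^1(\xi_1,\xi_2,\xi_3;x_1,x_2,x_3)=h^1\bigl(-2(1|x_3),\,2(1|x_3),\,0;\ \overline{x_2},\,\overline{x_1},\,\xi_2-\xi_1\bigr),$$ and let $\alpha\in\mathfrak{a}^*$ with $\alpha(H_0)=1$. Let $M$ and $\mathfrak{m}$ be the centralizers of $\mathfrak{a}$ in $K$ and in $\mathfrak{k}$. The roots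 of $(\mathfrak{g},\mathfrak{a})$ are $\pm\alpha,\pm2\alpha$, with root spaces $\mathfrak{g}_\lambda$, and $\mathfrak{g}=\mathfrak{a}\oplus\mathfrak{m}\oplus\bigoplus_\lambda\mathfrak{g}_\lambda$. Put $\epsilon(\pm\alpha)=-1$ and $\epsilon(\pm2\alpha)=1$, and let $\theta_\epsilon$ be the linear map on $\mathfrak{g}$ that is $\theta$ on $\mathfrak{a}\oplus\mathfrak{m}$ and $\epsilon(\lambda)\theta$ on each $\mathfrak{g}_\lambda$. Let $\mathfrak{k}_\epsilon=\{X\in\mathfrak{g}\mid\theta_\epsilon(X)=X\}$, let $(K_\epsilon)^0$ be the connected Lie subgroup of $G$ with Lie algebra $\mathfrak{k}_\epsilon$, and let $K_\epsilon=(K_\epsilon)^0M$, which is a subgroup of $G$. Let $\mathcal{N}_1^-=\{X\in\mathcal{J}^1\mid X\times X=0,\ \mathrm{tr}(X)=0,\ (E_1|X)<0\}$, and let $\mathcal{F}=\mathcal{N}_1^- /\!\sim$, where $X\sim Y$ if and only if $Y=rX$ for some $r>0$; write $[X]$ for the class of $X$. The group $K_\epsilon$ acts on $\mathcal{F}$ by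 $g[X]=[gX]$. **Theorem.** $\mathcal{F}$ decomposes into exactly two $K_\epsilon$-orbits, $$\mathcal{F}=K_\epsilon\cdot[P^-_{12}]\ \sqcup\ K_\epsilon\cdot[P^-_{13}]\quad\text{(disjoint union)},$$ where $$K_\epsilon\cdot[P^-_{12}]=\{[X]\in\mathcal{F}\mid (X|E_2)\neq0\}=\{[X]\in\mathcal{F}\mid (X|E_2)>0\},\qquad K_\epsilon\cdot[P^-_{13}]=\{[X]\in\mathcal{F}\mid (X|E_2)=0\}.$$ -/

import Mathlib

open scoped Quaternion

noncomputable section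

namespace F4Minus20

/-! ### Octonions -/

/-- Octonions with coefficients in `R`, in coordinates with respect to the natural units
`1 = e₀, e₁, …, e₇`. `Oct ℝ` is the division algebra of octonions and `Oct ℂ` its
complexification. Addition, scalar multiplication and topology are those of `R⁸`; the
multiplication is `octMul` below (the pointwise product of functions is never used). -/
abbrev Oct (R : Type) : Type := Fin 8 → R

/-- The quaternion `a` in the Cayley--Dickson decomposition `x = a + b e₄`. -/
def octFst {R : Type} [CommRing R] (x : Oct R) : ℍ[R] := ⟨x 0, x 1, x 2, x 3⟩

/-- The quaternion `b` in the Cayley--Dickson decomposition `x = a + b e₄`. -/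
def octSnd {R : Type} [CommRing R] (x : Oct R) : ℍ[R] := ⟨x 4, x 5, x 6, x 7⟩

@[simp] theorem octFst_re {R : Type} [CommRing R] (x : Oct R) : (octFst x).re = x 0 := rfl

@[simp] theorem octFst_imI {R : Type} [CommRing R] (x : Oct R) : (octFst x).imI = x 1 := rfl

@[simp] theorem octFst_imJ {R : Type} [CommRing R] (x : Oct R) : (octFst x).imJ = x 2 := rfl

@[simp] theorem octFst_imK {R : Type} [CommRing R] (x : Oct R) : (octFst x).imK = x 3 := rfl

@[simp] theorem octSnd_re {R : Type} [CommRing R] (x : Oct R) : (octSnd x).re = x 4 := rfl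

@[simp] theorem octSnd_imI {R : Type} [CommRing R] (x : Oct R) : (octSnd x).imI = x 5 := rfl

@[simp] theorem octSnd_imJ {R : Type} [CommRing R] (x : Oct R) : (octSnd x).imJ = x 6 := rfl

@[simp] theorem octSnd_imK {R : Type} [CommRing R] (x : Oct R) : (octSnd x).imK = x 7 := rfl

/-- The octonion `a + b e₄`. -/
def octPair {R : Type} [CommRing R] (a b : ℍ[R]) : Oct R :=
  ![a.re, a.imI, a.imJ, a.imK, b.re, b.imI, b.imJ, b.imK]

/-- The octonion product `(a + b e₄)(c + d e₄) = (a c - d̄ b) + (d a + b c̄) e₄`. -/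
def octMul {R : Type} [CommRing R] (x y : Oct R) : Oct R :=
  octPair (octFst x * octFst y - star (octSnd y) * octSnd x)
    (octSnd y * octFst x + octSnd x * star (octFst y))

/-- The octonion conjugation (it is `R`-linear, also for `R = ℂ`). -/
def octConj {R : Type} [CommRing R] (x : Oct R) : Oct R :=
  octPair (star (octFst x)) (-octSnd x)

/-- The unit octonion. -/
def octOne {R : Type} [CommRing R] : Oct R := octPair 1 0

/-- The inner product `(x|y) = Re (x ȳ)`. -/
def octInner {R : Type} [CommRing R] (x y : Oct R) : R := octMul x (octConj y) 0

/-- The inclusion of the real octonions into the complexified ones. -/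
def octToComplex (x : Oct ℝ) : Oct ℂ := fun i => (x i : ℂ)

theorem oct_ext {R : Type} [CommRing R] {x y : Oct R} (h : octFst x = octFst y)
    (h' : octSnd x = octSnd y) : x = y := by
  funext i
  fin_cases i
  · exact congrArg QuaternionAlgebra.re h
  · exact congrArg QuaternionAlgebra.imI h
  · exact congrArg QuaternionAlgebra.imJ h
  · exact congrArg QuaternionAlgebra.imK h
  · exact congrArg QuaternionAlgebra.re h'
  · exact congrArg QuaternionAlgebra.imI h'
  · exact congrArg QuaternionAlgebra.imJ h'
  · exact congrArg QuaternionAlgebra.imK h'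

section
variable {R : Type} [CommRing R]

@[simp] theorem octFst_pair (a b : ℍ[R]) : octFst (octPair a b) = a := rfl

@[simp] theorem octSnd_pair (a b : ℍ[R]) : octSnd (octPair a b) = b := rfl

@[simp] theorem octFst_add (x y : Oct R) : octFst (x + y) = octFst x + octFst y := rfl

@[simp] theorem octSnd_add (x y : Oct R) : octSnd (x + y) = octSnd x + octSnd y := rfl

@[simp] theorem octFst_sub (x y : Oct R) : octFst (x - y) = octFst x - octFst y := rfl

@[simp] theorem octSnd_sub (x y : Oct R) : octSnd (x - y) = octSnd x - octSnd y := rfl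

@[simp] theorem octFst_smul (c : R) (x : Oct R) : octFst (c • x) = c • octFst x := rfl

@[simp] theorem octSnd_smul (c : R) (x : Oct R) : octSnd (c • x) = c • octSnd x := rfl

theorem octConj_add (x y : Oct R) : octConj (x + y) = octConj x + octConj y := by
  apply oct_ext <;> simp [octConj, add_comm]

theorem octConj_sub (x y : Oct R) : octConj (x - y) = octConj x - octConj y := by
  apply oct_ext <;> simp [octConj]
  abel

theorem octConj_smul (c : R) (x : Oct R) : octConj (c • x) = c • octConj x := by
  apply oct_ext <;> simp [octConj]

theorem octMul_smul_left (c : R) (x y : Oct R) : octMul (c • x) y = c • octMul x y := by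
  apply oct_ext <;> simp [octMul, smul_sub]

theorem octMul_smul_right (c : R) (x y : Oct R) : octMul x (c • y) = c • octMul x y := by
  apply oct_ext <;> simp [octMul, smul_sub]

theorem octMul_one (x : Oct R) : octMul x octOne = x := by
  apply oct_ext <;> simp [octMul, octOne]

theorem one_octMul (x : Oct R) : octMul octOne x = x := by
  apply oct_ext <;> simp [octMul, octOne]

theorem octConj_octMul (x y : Oct R) :
    octConj (octMul x y) = octMul (octConj y) (octConj x) := by
  apply oct_ext <;> simp [octMul, octConj, add_comm]

theorem octConj_octConj (x : Oct R) : octConj (octConj x) = x := by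
  apply oct_ext <;> simp [octConj]

theorem octInner_eq_sum (x y : Oct R) : octInner x y = ∑ i, x i * y i := by
  change (octFst (octMul x (octConj y))).re = _
  simp [octMul, octConj, Fin.sum_univ_eight]
  ring

theorem octMul_conj_add (x y : Oct R) :
    octMul x (octConj y) + octMul y (octConj x) = (2 * octInner x y) • octOne := by
  rw [octInner_eq_sum]
  apply oct_ext
  · ext <;> simp [octMul, octConj, octOne, Fin.sum_univ_eight] <;> ring
  · simp [octMul, octConj, octOne]

theorem octConj_mul_add (x y : Oct R) :
    octMul (octConj x) y + octMul (octConj y) x = (2 * octInner x y) • octOne := by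
  have h := octMul_conj_add (octConj x) (octConj y)
  have h' : octInner (octConj x) (octConj y) = octInner x y := by
    simp [octInner_eq_sum, octConj, octPair, Fin.sum_univ_eight]
  rwa [octConj_octConj, octConj_octConj, h'] at h

end

theorem octMul_toComplex (x y : Oct ℝ) :
    octMul (octToComplex x) (octToComplex y) = octToComplex (octMul x y) := by
  funext i
  fin_cases i <;> simp [octMul, octPair, octToComplex]

theorem octToComplex_one : octToComplex octOne = octOne := by
  funext i
  fin_cases i <;> simp [octToComplex, octOne, octPair]

theorem octToComplex_add (x y : Oct ℝ) :
    octToComplex (x + y) = octToComplex x + octToComplex y := by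
  funext i
  simp [octToComplex]

theorem octToComplex_sub (x y : Oct ℝ) :
    octToComplex (x - y) = octToComplex x - octToComplex y := by
  funext i
  simp [octToComplex]

theorem octToComplex_smul (c : ℝ) (x : Oct ℝ) :
    octToComplex (c • x) = (c : ℂ) • octToComplex x := by
  funext i
  simp [octToComplex]

/-! ### The exceptional Jordan algebra -/

/-- The underlying space of the Jordan algebra `𝒥¹`: coordinates `(ξ₁, ξ₂, ξ₃)` and
`(x₁, x₂, x₃)`, indexed by `0, 1, 2`. -/
abbrev J1 : Type := (Fin 3 → ℝ) × (Fin 3 → Oct ℝ)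

/-- The element `h¹(ξ₁, ξ₂, ξ₃; x₁, x₂, x₃)`. -/
def h1 (a b c : ℝ) (x y z : Oct ℝ) : J1 := (![a, b, c], ![x, y, z])

/-- The Hermitian-type matrix over the complexified octonions represented by an element. -/
def toMatrix (X : J1) : Matrix (Fin 3) (Fin 3) (Oct ℂ) :=
  !![(X.1 0 : ℂ) • octOne, Complex.I • octToComplex (X.2 2),
      Complex.I • octToComplex (octConj (X.2 1));
     Complex.I • octToComplex (octConj (X.2 2)), (X.1 1 : ℂ) • octOne, octToComplex (X.2 0);
     Complex.I • octToComplex (X.2 1), octToComplex (octConj (X.2 0)), (X.1 2 : ℂ) • octOne]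

/-- The Jordan product `X ∘ Y = (XY + YX)/2` in coordinates; see `toMatrix_jordan`. -/
def jordan (X Y : J1) : J1 :=
  h1 (X.1 0 * Y.1 0 - octInner (X.2 1) (Y.2 1) - octInner (X.2 2) (Y.2 2))
     (X.1 1 * Y.1 1 + octInner (X.2 0) (Y.2 0) - octInner (X.2 2) (Y.2 2))
     (X.1 2 * Y.1 2 + octInner (X.2 0) (Y.2 0) - octInner (X.2 1) (Y.2 1))
     ((1 / 2 : ℝ) • ((X.1 1 + X.1 2) • Y.2 0 + (Y.1 1 + Y.1 2) • X.2 0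
        - octConj (octMul (X.2 1) (Y.2 2)) - octConj (octMul (Y.2 1) (X.2 2))))
     ((1 / 2 : ℝ) • ((X.1 2 + X.1 0) • Y.2 1 + (Y.1 2 + Y.1 0) • X.2 1
        + octConj (octMul (X.2 2) (Y.2 0)) + octConj (octMul (Y.2 2) (X.2 0))))
     ((1 / 2 : ℝ) • ((X.1 0 + X.1 1) • Y.2 2 + (Y.1 0 + Y.1 1) • X.2 2
        + octConj (octMul (X.2 0) (Y.2 1)) + octConj (octMul (Y.2 0) (X.2 1))))

/-- The coordinate formula is the symmetrized matrix product over the complexified octonions. -/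
theorem toMatrix_jordan (X Y : J1) (i j : Fin 3) :
    toMatrix (jordan X Y) i j = (1 / 2 : ℂ) •
      (∑ k, octMul (toMatrix X i k) (toMatrix Y k j) +
        ∑ k, octMul (toMatrix Y i k) (toMatrix X k j)) := by
  have A (x y : Oct ℝ) : octToComplex (octMul x (octConj y)) =
      (2 * octInner x y : ℂ) • octOne - octToComplex (octMul y (octConj x)) := by
    rw [eq_sub_iff_add_eq, ← octToComplex_add, octMul_conj_add, octToComplex_smul,
      octToComplex_one, Complex.ofReal_mul, Complex.ofReal_ofNat]
  have B (x y : Oct ℝ) : octToComplex (octMul (octConj x) y) =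
      (2 * octInner x y : ℂ) • octOne - octToComplex (octMul (octConj y) x) := by
    rw [eq_sub_iff_add_eq, ← octToComplex_add, octConj_mul_add, octToComplex_smul,
      octToComplex_one, Complex.ofReal_mul, Complex.ofReal_ofNat]
  fin_cases i <;> fin_cases j <;>
    simp only [toMatrix, jordan, h1, Fin.sum_univ_three, octMul_smul_left, octMul_smul_right,
      octMul_one, one_octMul, octMul_toComplex, octToComplex_add, octToComplex_sub,
      octToComplex_smul, octConj_add, octConj_sub, octConj_smul, octConj_octMul, octConj_octConj,
      Matrix.of_apply, Matrix.cons_val, Matrix.cons_val_zero, Matrix.cons_val_one,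
      Fin.zero_eta, Fin.mk_one, Fin.reduceFinMk, A (X.2 _) (Y.2 _), B (X.2 _) (Y.2 _)] <;>
    match_scalars <;> ring_nf <;> simp only [Complex.I_sq] <;> ring

/-- The trace. -/
def tr (X : J1) : ℝ := X.1 0 + X.1 1 + X.1 2

/-- The inner product `(X|Y) = tr (X ∘ Y)`. -/
def inn (X Y : J1) : ℝ := tr (jordan X Y)

/-- The unit element `E`. -/
def unitE : J1 := h1 1 1 1 0 0 0

/-- The primitive idempotent `E₁`. -/
def E1 : J1 := h1 1 0 0 0 0 0

/-- The primitive idempotent `E₂`. -/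
def E2 : J1 := h1 0 1 0 0 0 0

/-- The cross product. -/
def cross (X Y : J1) : J1 :=
  (1 / 2 : ℝ) • ((2 : ℝ) • jordan X Y - tr X • Y - tr Y • X + (tr X * tr Y - inn X Y) • unitE)

/-- The exceptional null cone `𝒩₁⁻`. -/
def N1minus : Set J1 := {X | cross X X = 0 ∧ tr X = 0 ∧ inn E1 X < 0}

/-- `P₁₂⁻ = h¹(-1, 1, 0; 0, 0, 1)`. -/
def P12 : J1 := h1 (-1) 1 0 0 0 octOne

/-- `P₁₃⁻ = h¹(-1, 0, 1; 0, 1, 0)`. -/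
def P13 : J1 := h1 (-1) 0 1 0 octOne 0

/-! ### The group `F₄₍₋₂₀₎` and its Lie algebra -/

/-- The general linear group of `𝒥¹` (linear maps are continuous in finite dimension). -/
abbrev GLJ : Type := J1 ≃L[ℝ] J1

/-- `F₄₍₋₂₀₎`, the group of linear automorphisms of the Jordan product. -/
def F4 : Subgroup GLJ where
  carrier := {g | ∀ X Y, g (jordan X Y) = jordan (g X) (g Y)}
  mul_mem' := by
    intro a b ha hb X Y
    change a (b (jordan X Y)) = jordan (a (b X)) (a (b Y))
    rw [hb, ha]
  one_mem' := fun _ _ => rfl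
  inv_mem' := by
    intro a ha X Y
    apply a.injective
    have key : ∀ Z, a ((a⁻¹ : GLJ) Z) = Z := fun Z => a.apply_symm_apply Z
    rw [ha, key, key, key]

/-- The Lie algebra of the linear group `F₄₍₋₂₀₎`: all `D` with `exp (tD)` in the group for every
real `t`. -/
def f4 : Set (J1 →L[ℝ] J1) :=
  {D | ∀ t : ℝ, ∃ g ∈ F4, (g : J1 →L[ℝ] J1) = NormedSpace.exp (t • D)}

/-- The involution `σ = σ₁`: it fixes `ξ₁, ξ₂, ξ₃, x₁` and changes the signs of `x₂, x₃`. -/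
def sigma : GLJ :=
  LinearEquiv.toContinuousLinearEquiv
    { toFun := fun X => h1 (X.1 0) (X.1 1) (X.1 2) (X.2 0) (-X.2 1) (-X.2 2)
      invFun := fun X => h1 (X.1 0) (X.1 1) (X.1 2) (X.2 0) (-X.2 1) (-X.2 2)
      map_add' := by
        intro X Y
        refine Prod.ext ?_ ?_ <;> funext i <;> fin_cases i <;> simp [h1, add_comm]
      map_smul' := by
        intro c X
        refine Prod.ext ?_ ?_ <;> funext i <;> fin_cases i <;> simp [h1]
      left_inv := by
        intro X
        refine Prod.ext ?_ ?_ <;> funext i <;> fin_cases i <;> simp [h1]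
      right_inv := by
        intro X
        refine Prod.ext ?_ ?_ <;> funext i <;> fin_cases i <;> simp [h1] }

/-- `K`, the subgroup of `F₄₍₋₂₀₎` fixed by the conjugation with `σ`. -/
def K : Subgroup GLJ := F4 ⊓ Subgroup.centralizer {sigma}

/-- The adjoint action `D ↦ g D g⁻¹` of the linear group on endomorphisms. -/
def Ad (g : GLJ) (D : J1 →L[ℝ] J1) : J1 →L[ℝ] J1 :=
  (g : J1 →L[ℝ] J1) * D * ((g⁻¹ : GLJ) : J1 →L[ℝ] J1)

/-- The Cartan involution `θ`, the differential of the conjugation with `σ`. -/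
def theta (D : J1 →L[ℝ] J1) : J1 →L[ℝ] J1 := Ad sigma D

/-- The generator `Ã₃¹(1)` of the maximal abelian subspace `𝔞`, the derivation
`h¹(ξ; x) ↦ h¹(-2 (1|x₃), 2 (1|x₃), 0; x̄₂, x̄₁, (ξ₂ - ξ₁) 1)`. -/
def A31 : J1 →L[ℝ] J1 :=
  LinearMap.toContinuousLinearMap
    { toFun := fun X =>
        h1 (-2 * octInner octOne (X.2 2)) (2 * octInner octOne (X.2 2)) 0
          (octConj (X.2 1)) (octConj (X.2 0)) ((X.1 1 - X.1 0) • octOne)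
      map_add' := by
        intro X Y
        refine Prod.ext ?_ ?_ <;> funext i <;> fin_cases i <;>
          simp [h1, octConj_add, octInner_eq_sum, mul_add, Finset.sum_add_distrib]
        rw [← add_smul]
        congr 1
        ring
      map_smul' := by
        intro c X
        refine Prod.ext ?_ ?_ <;> funext i <;> fin_cases i <;>
          simp [h1, octConj_smul, octInner_eq_sum, Finset.mul_sum, mul_left_comm,
            mul_sub, smul_smul] }

/-- The maximal abelian subspace `𝔞 = ℝ Ã₃¹(1)`. -/
def aa : Set (J1 →L[ℝ] J1) := {H | ∃ t : ℝ, H = t • A31}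

/-- `𝔪`, the centralizer of `𝔞` in the Lie algebra of `K`. -/
def mm : Set (J1 →L[ℝ] J1) := {D | D ∈ f4 ∧ theta D = D ∧ ⁅D, A31⁆ = 0}

/-- The root space of `c α`, where `α (t Ã₃¹(1)) = t`. -/
def rootSpace (c : ℤ) : Set (J1 →L[ℝ] J1) :=
  {D | D ∈ f4 ∧ ∀ t : ℝ, ⁅t • A31, D⁆ = ((c : ℝ) * t) • D}

/-- The roots `±α, ±2α`, recorded by their coefficients. -/
def roots : Finset ℤ := {1, -1, 2, -2}

/-- The signature of roots: `ε(±α) = -1` and `ε(±2α) = 1`. -/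
def eps (c : ℤ) : ℝ := if c = 1 ∨ c = -1 then -1 else 1

/-- The graph of the involution `θ_ε`: it is `θ` on `𝔞 ⊕ 𝔪` and `ε(λ) θ` on the root space of `λ`,
extended linearly along the root space decomposition. -/
def IsThetaEps (D D' : J1 →L[ℝ] J1) : Prop :=
  ∃ H ∈ aa, ∃ Z ∈ mm, ∃ V : ℤ → (J1 →L[ℝ] J1), (∀ c ∈ roots, V c ∈ rootSpace c) ∧
    D = H + Z + ∑ c ∈ roots, V c ∧
    D' = theta (H + Z) + ∑ c ∈ roots, eps c • theta (V c)

/-- `𝔨_ε`, the fixed points of `θ_ε`. -/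
def kEps : Set (J1 →L[ℝ] J1) := {D | IsThetaEps D D}

/-- `(K_ε)⁰`, the connected Lie subgroup with Lie algebra `𝔨_ε`, that is, the subgroup generated
by the exponentials of the elements of `𝔨_ε`. -/
def KEps0 : Subgroup GLJ :=
  Subgroup.closure {g | ∃ D ∈ kEps, (g : J1 →L[ℝ] J1) = NormedSpace.exp D}

/-- `M`, the centralizer of `𝔞` in `K`. -/
def M : Subgroup GLJ where
  carrier := {k | k ∈ K ∧ Ad k A31 = A31}
  mul_mem' := by
    rintro a b ⟨ha, ha'⟩ ⟨hb, hb'⟩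
    refine ⟨mul_mem ha hb, ?_⟩
    have h : Ad (a * b) A31 = Ad a (Ad b A31) := rfl
    rw [h, hb', ha']
  one_mem' := ⟨one_mem _, rfl⟩
  inv_mem' := by
    rintro a ⟨ha, ha'⟩
    refine ⟨inv_mem ha, ?_⟩
    have h : Ad a⁻¹ (Ad a A31) = A31 := by
      refine ContinuousLinearMap.ext fun X => ?_
      change (a⁻¹ * a : GLJ) (A31 ((a⁻¹⁻¹⁻¹ * a⁻¹⁻¹ : GLJ) X)) = A31 X
      rw [inv_mul_cancel, inv_mul_cancel]
      rfl
    rwa [ha'] at h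

theorem Ad_mul (a b : GLJ) (D : J1 →L[ℝ] J1) : Ad (a * b) D = Ad a (Ad b D) := rfl

theorem Ad_one (D : J1 →L[ℝ] J1) : Ad 1 D = D := rfl

theorem Ad_lie (g : GLJ) (D D' : J1 →L[ℝ] J1) : Ad g ⁅D, D'⁆ = ⁅Ad g D, Ad g D'⁆ := by
  have key : ∀ A B : J1 →L[ℝ] J1, Ad g (A * B) = Ad g A * Ad g B := by
    intro A B
    refine ContinuousLinearMap.ext fun X => ?_
    change g (A (B _)) = g (A ((g⁻¹ * g : GLJ) (B _)))
    rw [inv_mul_cancel]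
    rfl
  simp only [Ring.lie_def, ← key]
  simp [Ad, mul_sub, sub_mul]

theorem Ad_add (g : GLJ) (D D' : J1 →L[ℝ] J1) : Ad g (D + D') = Ad g D + Ad g D' := by
  simp [Ad, mul_add, add_mul]

theorem Ad_smul (g : GLJ) (c : ℝ) (D : J1 →L[ℝ] J1) : Ad g (c • D) = c • Ad g D := by
  simp [Ad]

theorem Ad_sum (g : GLJ) (s : Finset ℤ) (V : ℤ → (J1 →L[ℝ] J1)) :
    Ad g (∑ c ∈ s, V c) = ∑ c ∈ s, Ad g (V c) := by
  simp [Ad, Finset.mul_sum, Finset.sum_mul]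

theorem exp_Ad (g : GLJ) (D : J1 →L[ℝ] J1) :
    NormedSpace.exp (Ad g D) = Ad g (NormedSpace.exp D) := by
  let u : (J1 →L[ℝ] J1)ˣ :=
    ⟨(g : J1 →L[ℝ] J1), ((g⁻¹ : GLJ) : J1 →L[ℝ] J1),
      ContinuousLinearMap.ext fun X => g.apply_symm_apply X,
      ContinuousLinearMap.ext fun X => g.symm_apply_apply X⟩
  let : NormedAlgebra ℚ (J1 →L[ℝ] J1) := NormedAlgebra.restrictScalars ℚ ℝ (J1 →L[ℝ] J1)
  exact NormedSpace.exp_units_conj u D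

theorem Ad_coe (g a : GLJ) : Ad g (a : J1 →L[ℝ] J1) = ((g * a * g⁻¹ : GLJ) : J1 →L[ℝ] J1) := rfl

theorem Ad_mem_f4 {g : GLJ} (hg : g ∈ F4) {D : J1 →L[ℝ] J1} (hD : D ∈ f4) : Ad g D ∈ f4 := by
  intro t
  obtain ⟨a, ha, ha'⟩ := hD t
  exact ⟨g * a * g⁻¹, mul_mem (mul_mem hg ha) (inv_mem hg), by
    rw [← Ad_coe, ha', ← exp_Ad, Ad_smul]⟩

theorem Ad_theta {g : GLJ} (hg : g ∈ K) (D : J1 →L[ℝ] J1) : Ad g (theta D) = theta (Ad g D) := by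
  have h : sigma * g = g * sigma := (Subgroup.mem_centralizer_iff.1 hg.2) sigma rfl
  rw [theta, theta, ← Ad_mul, ← Ad_mul, h]

theorem Ad_mem_kEps {m : GLJ} (hm : m ∈ M) {D : J1 →L[ℝ] J1} (hD : D ∈ kEps) :
    Ad m D ∈ kEps := by
  obtain ⟨H, ⟨t, rfl⟩, Z, ⟨hZ, hZ', hZ''⟩, V, hV, h1, h2⟩ := hD
  obtain ⟨hK, hA⟩ := hm
  refine ⟨t • A31, ⟨t, rfl⟩, Ad m Z, ⟨Ad_mem_f4 hK.1 hZ, ?_, ?_⟩, fun c => Ad m (V c), ?_, ?_, ?_⟩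
  · rw [← Ad_theta hK, hZ']
  · nth_rw 1 [← hA]
    rw [← Ad_lie, hZ'']
    simp [Ad]
  · intro c hc
    refine ⟨Ad_mem_f4 hK.1 (hV c hc).1, fun s => ?_⟩
    rw [← Ad_smul, ← (hV c hc).2 s, Ad_lie, Ad_smul, hA]
  · conv_lhs => rw [h1]
    rw [Ad_add, Ad_add, Ad_smul, hA, Ad_sum]
  · conv_lhs => rw [h2]
    rw [Ad_add, Ad_theta hK, Ad_add, Ad_smul, hA, Ad_sum]
    simp only [Ad_smul, Ad_theta hK]

/-- `M` normalizes `(K_ε)⁰`. -/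
theorem conj_mem_KEps0 {m k : GLJ} (hm : m ∈ M) (hk : k ∈ KEps0) : m * k * m⁻¹ ∈ KEps0 := by
  have h : KEps0 ≤ KEps0.comap (MulAut.conj m).toMonoidHom := by
    refine (Subgroup.closure_le _).2 ?_
    rintro g ⟨D, hD, hg⟩
    refine Subgroup.subset_closure ⟨Ad m D, Ad_mem_kEps hm hD, ?_⟩
    rw [exp_Ad, ← hg]
    rfl
  exact h hk

/-- The group `K_ε = (K_ε)⁰ M`. -/
def KEps : Subgroup GLJ where
  carrier := {g | ∃ k ∈ KEps0, ∃ m ∈ M, g = k * m}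
  mul_mem' := by
    rintro _ _ ⟨k, hk, m, hm, rfl⟩ ⟨k', hk', m', hm', rfl⟩
    exact ⟨k * (m * k' * m⁻¹), mul_mem hk (conj_mem_KEps0 hm hk'), m * m', mul_mem hm hm',
      by group⟩
  one_mem' := ⟨1, one_mem _, 1, one_mem _, (one_mul 1).symm⟩
  inv_mem' := by
    rintro _ ⟨k, hk, m, hm, rfl⟩
    refine ⟨m⁻¹ * k⁻¹ * m⁻¹⁻¹, conj_mem_KEps0 (inv_mem hm) (inv_mem hk), m⁻¹, inv_mem hm, ?_⟩
    group

/-! ### The space `ℱ` of rays of the null cone -/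

/-- Two elements are equivalent if they differ by a positive factor. -/
def raySetoid : Setoid J1 where
  r X Y := ∃ r : ℝ, 0 < r ∧ Y = r • X
  iseqv :=
    { refl := fun X => ⟨1, one_pos, (one_smul ℝ X).symm⟩
      symm := by
        rintro X _ ⟨r, hr, rfl⟩
        exact ⟨r⁻¹, inv_pos.2 hr, (inv_smul_smul₀ hr.ne' X).symm⟩
      trans := by
        rintro X _ _ ⟨r, hr, rfl⟩ ⟨s, hs, rfl⟩
        exact ⟨s * r, mul_pos hs hr, smul_smul s r X⟩ }

/-- The classes `[X]` of all elements of `𝒥¹`. -/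
def Rays : Type := Quotient raySetoid

/-- The class `[X]`. -/
def ray (X : J1) : Rays := Quotient.mk raySetoid X

/-- The linear group acts on classes by `g [X] = [g X]`. -/
instance : MulAction GLJ Rays where
  smul g := Quotient.map' g (by
    rintro X _ ⟨r, hr, rfl⟩
    exact ⟨r, hr, map_smul g r X⟩)
  one_smul := by
    rintro ⟨X⟩
    rfl
  mul_smul := by
    rintro g h ⟨X⟩
    rfl

theorem smul_ray (g : GLJ) (X : J1) : g • ray X = ray (g X) := rfl

/-- `ℱ = 𝒩₁⁻/∼`, the set of the classes of the elements of `𝒩₁⁻`. (The null cone is stable under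
positive factors, so these are the classes of the restriction of `∼` to `𝒩₁⁻`.) -/
def FF : Set Rays := ray '' N1minus

end F4Minus20

end

noncomputable section

namespace F4Minus20

/-! ### Octonion identities -/

/-! The number `(X|E₂)`, which is the coordinate `ξ₂` of `X`, is a complete invariant of the action
of `K_ε` on the null cone up to positive scaling. On the cone the defining conditions reduce to `X ∘
X = 0` and `ξ₁ < 0` (`mem_N1minus_iff`), and then `ξ₁ξ₂ = -|x₃|²` gives `ξ₂ ≥ 0`. So only `ξ₂ > 0`
and `ξ₂ = 0` occur.

Invariance (`KEps_le_stabE2`): every element of `K_ε` fixes `E₂`, hence preserves `ξ₂`, because the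
Peirce projection onto `ℝE₂` is a polynomial in multiplication by `E₂`. For `M` this holds since `K`
fixes `E₁` (`K_fix_E1`) and `E₂` is obtained from `E₁` by applying the generator of `𝔞`. For `𝔨_ε`,
comparing eigencomponents of `ad Ã₃¹(1)` in `θ_ε D = D` leaves `D = Z + W + W'` with `Z ∈ 𝔪`, `θW =
-W`, `ad² W = W` and `θW' = W'`, `ad² W' = 4W'`; each summand kills `E₂`
(`kEps_isDer_and_apply_E2`). The sign of `ξ₁` survives along one-parameter groups because a null `X
≠ 0` never has `ξ₁ = 0`.

Transitivity: explicit elements of `K_ε` suffice. The compact `rotationDer a`, in the `±2α` part,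
turns `x₃` into a real `c ≥ 0`; products of triality elements of `M` then make `x₁` a real `s ≥ 0`
without moving `x₃`. If `ξ₂ = 1`, the null relations force `c² = 1 + s²` and determine all other
coordinates, and this curve of normal forms is the orbit of `P12` under the noncompact `boostDer`,
in the `±α` part (`exists_KEps_eq_P12`). If `ξ₂ = 0`, then `x₁ = x₃ = 0` and `M` alone carries `x₂`
to a positive real (`exists_KEps_eq_P13`). -/

theorem octMul_eq (x y : Oct ℝ) : octMul x y =
    ![x 0 * y 0 - x 1 * y 1 - x 2 * y 2 - x 3 * y 3 - x 4 * y 4 - x 5 * y 5 - x 6 * y 6 - x 7 * y 7,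
      x 0 * y 1 + x 1 * y 0 + x 2 * y 3 - x 3 * y 2 + x 4 * y 5 - x 5 * y 4 - x 6 * y 7 + x 7 * y 6,
      x 0 * y 2 - x 1 * y 3 + x 2 * y 0 + x 3 * y 1 + x 4 * y 6 + x 5 * y 7 - x 6 * y 4 - x 7 * y 5,
      x 0 * y 3 + x 1 * y 2 - x 2 * y 1 + x 3 * y 0 + x 4 * y 7 - x 5 * y 6 + x 6 * y 5 - x 7 * y 4,
      x 0 * y 4 - x 1 * y 5 - x 2 * y 6 - x 3 * y 7 + x 4 * y 0 + x 5 * y 1 + x 6 * y 2 + x 7 * y 3,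
      x 0 * y 5 + x 1 * y 4 - x 2 * y 7 + x 3 * y 6 - x 4 * y 1 + x 5 * y 0 - x 6 * y 3 + x 7 * y 2,
      x 0 * y 6 + x 1 * y 7 + x 2 * y 4 - x 3 * y 5 - x 4 * y 2 + x 5 * y 3 + x 6 * y 0 - x 7 * y 1,
      x 0 * y 7 - x 1 * y 6 + x 2 * y 5 + x 3 * y 4 - x 4 * y 3 - x 5 * y 2 + x 6 * y 1 + x 7 * y 0]
    := by
  funext i
  fin_cases i <;> simp [octMul, octPair] <;> ring

theorem octConj_eq (x : Oct ℝ) :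
    octConj x = ![x 0, -x 1, -x 2, -x 3, -x 4, -x 5, -x 6, -x 7] := by
  funext i
  fin_cases i <;> simp [octConj, octPair]

theorem octOne_eq : (octOne : Oct ℝ) = ![1, 0, 0, 0, 0, 0, 0, 0] := by
  funext i
  fin_cases i <;> simp [octOne, octPair]

theorem octMul_add_left (x y z : Oct ℝ) : octMul (x + y) z = octMul x z + octMul y z := by
  apply oct_ext <;> simp [octMul, add_mul, mul_add] <;> abel

theorem octMul_add_right (x y z : Oct ℝ) : octMul x (y + z) = octMul x y + octMul x z := by
  apply oct_ext <;> simp [octMul, add_mul, mul_add] <;> abel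

theorem octMul_neg_left (x y : Oct ℝ) : octMul (-x) y = -octMul x y := by
  simpa using octMul_smul_left (-1 : ℝ) x y

theorem octMul_neg_right (x y : Oct ℝ) : octMul x (-y) = -octMul x y := by
  simpa using octMul_smul_right (-1 : ℝ) x y

theorem octMul_zero_left (y : Oct ℝ) : octMul 0 y = 0 := by
  simpa using octMul_smul_left (0 : ℝ) 0 y

theorem octMul_zero_right (x : Oct ℝ) : octMul x 0 = 0 := by
  simpa using octMul_smul_right (0 : ℝ) x 0

theorem octConj_neg (x : Oct ℝ) : octConj (-x) = -octConj x := by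
  simpa using octConj_smul (-1 : ℝ) x

theorem octConj_zero : octConj (0 : Oct ℝ) = 0 := by
  simpa using octConj_smul (0 : ℝ) 0

theorem octConj_one : octConj (octOne : Oct ℝ) = octOne := by
  simp [octConj_eq, octOne_eq]

theorem octInner_comm (x y : Oct ℝ) : octInner x y = octInner y x := by
  simp only [octInner_eq_sum, mul_comm]

theorem octInner_add_left (x y z : Oct ℝ) :
    octInner (x + y) z = octInner x z + octInner y z := by
  simp [octInner_eq_sum, add_mul, Finset.sum_add_distrib]

theorem octInner_add_right (x y z : Oct ℝ) :
    octInner x (y + z) = octInner x y + octInner x z := by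
  simp [octInner_eq_sum, mul_add, Finset.sum_add_distrib]

theorem octInner_smul_left (c : ℝ) (x y : Oct ℝ) : octInner (c • x) y = c * octInner x y := by
  simp [octInner_eq_sum, Finset.mul_sum, mul_assoc]

theorem octInner_smul_right (c : ℝ) (x y : Oct ℝ) : octInner x (c • y) = c * octInner x y := by
  simp [octInner_eq_sum, Finset.mul_sum, mul_left_comm]

theorem octInner_neg_left (x y : Oct ℝ) : octInner (-x) y = -octInner x y := by
  simp [octInner_eq_sum]

theorem octInner_neg_right (x y : Oct ℝ) : octInner x (-y) = -octInner x y := by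
  simp [octInner_eq_sum]

theorem octInner_zero_left (y : Oct ℝ) : octInner 0 y = 0 := by simp [octInner_eq_sum]

theorem octInner_zero_right (x : Oct ℝ) : octInner x 0 = 0 := by simp [octInner_eq_sum]

theorem octInner_one_left (x : Oct ℝ) : octInner octOne x = x 0 := by
  simp [octInner_eq_sum, octOne_eq, Fin.sum_univ_eight]

theorem octInner_conj (x y : Oct ℝ) : octInner (octConj x) (octConj y) = octInner x y := by
  simp [octInner_eq_sum, octConj_eq, Fin.sum_univ_eight]

theorem octInner_self_nonneg (x : Oct ℝ) : 0 ≤ octInner x x := by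
  rw [octInner_eq_sum]
  exact Finset.sum_nonneg fun i _ => mul_self_nonneg _

theorem octInner_self_eq_zero {x : Oct ℝ} : octInner x x = 0 ↔ x = 0 := by
  rw [octInner_eq_sum, Finset.sum_eq_zero_iff_of_nonneg fun i _ => mul_self_nonneg _]
  simp [funext_iff]

theorem octInner_mul_mul (x y : Oct ℝ) :
    octInner (octMul x y) (octMul x y) = octInner x x * octInner y y := by
  simp only [octInner_eq_sum, octMul_eq, Fin.sum_univ_eight, Matrix.cons_val]
  ring

/-- Polarization of the multiplicativity of the norm. -/
theorem octInner_mul_left (a x y : Oct ℝ) :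
    octInner (octMul a x) (octMul a y) = octInner a a * octInner x y := by
  have h := octInner_mul_mul a (x + y)
  simp only [octMul_add_right, octInner_add_left, octInner_add_right, octInner_mul_mul,
    octInner_comm y x, octInner_comm (octMul a y) (octMul a x)] at h
  linarith

theorem octInner_mul_right (a x y : Oct ℝ) :
    octInner (octMul x a) (octMul y a) = octInner a a * octInner x y := by
  rw [← octInner_conj, octConj_octMul, octConj_octMul, octInner_mul_left, octInner_conj,
    octInner_conj]

/-- The trilinear form `Re (x y z)` is invariant under cyclic permutations. -/
theorem octInner_conj_mul_cyclic (x y z : Oct ℝ) :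
    octInner (octConj (octMul x y)) z = octInner (octConj (octMul y z)) x := by
  simp only [octInner_eq_sum, octMul_eq, octConj_eq, Fin.sum_univ_eight, Matrix.cons_val]
  ring

theorem octMul_conj_mul (a x : Oct ℝ) :
    octMul (octConj a) (octMul a x) = octInner a a • x := by
  rw [octInner_eq_sum]
  funext i
  fin_cases i <;> simp [octMul_eq, octConj_eq, Fin.sum_univ_eight] <;> ring

theorem octMul_mul_conj (x a : Oct ℝ) :
    octMul (octMul x a) (octConj a) = octInner a a • x := by
  rw [octInner_eq_sum]
  funext i
  fin_cases i <;> simp [octMul_eq, octConj_eq, Fin.sum_univ_eight] <;> ring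

theorem octMul_flexible (a x : Oct ℝ) : octMul (octMul a x) a = octMul a (octMul x a) := by
  funext i
  fin_cases i <;> simp [octMul_eq] <;> ring

/-- The left Moufang identity. -/
theorem octMul_moufang_left (a x z : Oct ℝ) :
    octMul (octMul (octMul a x) a) z = octMul a (octMul x (octMul a z)) := by
  funext i
  fin_cases i <;> simp [octMul_eq] <;> ring

/-- The right Moufang identity. -/
theorem octMul_moufang_right (z a x : Oct ℝ) :
    octMul z (octMul (octMul a x) a) = octMul (octMul (octMul z a) x) a := by
  have h := congrArg octConj (octMul_moufang_left (octConj a) (octConj x) (octConj z))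
  simp only [octConj_octMul, octConj_octConj] at h
  rw [octMul_flexible, h]

/-- The middle Moufang identity. -/
theorem octMul_moufang_middle (a x y : Oct ℝ) :
    octMul (octMul a x) (octMul y a) = octMul (octMul a (octMul x y)) a := by
  funext i
  fin_cases i <;> simp [octMul_eq] <;> ring

theorem octConj_of_re_eq_zero {a : Oct ℝ} (ha : a 0 = 0) : octConj a = -a := by
  rw [octConj_eq]
  funext i
  fin_cases i <;> simp [ha]

/-! ### The Jordan product -/

section components
variable (a b c : ℝ) (x y z : Oct ℝ)

@[simp] theorem h1_fst_zero : (h1 a b c x y z).1 0 = a := rfl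
@[simp] theorem h1_fst_one : (h1 a b c x y z).1 1 = b := rfl
@[simp] theorem h1_fst_two : (h1 a b c x y z).1 2 = c := rfl
@[simp] theorem h1_snd_zero : (h1 a b c x y z).2 0 = x := rfl
@[simp] theorem h1_snd_one : (h1 a b c x y z).2 1 = y := rfl
@[simp] theorem h1_snd_two : (h1 a b c x y z).2 2 = z := rfl

end components

theorem J1_ext {X Y : J1} (a : X.1 0 = Y.1 0) (b : X.1 1 = Y.1 1) (c : X.1 2 = Y.1 2)
    (x : X.2 0 = Y.2 0) (y : X.2 1 = Y.2 1) (z : X.2 2 = Y.2 2) : X = Y := by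
  refine Prod.ext ?_ ?_ <;> funext i <;> fin_cases i <;> assumption

theorem jordan_comm (X Y : J1) : jordan X Y = jordan Y X := by
  apply J1_ext <;> simp only [jordan, h1_fst_zero, h1_fst_one, h1_fst_two, h1_snd_zero,
    h1_snd_one, h1_snd_two, octInner_comm (X.2 _) (Y.2 _)]
  · ring
  · ring
  · ring
  all_goals congr 1; abel

theorem jordan_add_left (X Y Z : J1) : jordan (X + Y) Z = jordan X Z + jordan Y Z := by
  apply J1_ext <;> simp only [jordan, h1_fst_zero, h1_fst_one, h1_fst_two, h1_snd_zero,
    h1_snd_one, h1_snd_two, Prod.fst_add, Prod.snd_add, Pi.add_apply, octInner_add_left,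
    octMul_add_left, octMul_add_right, octConj_add]
  · ring
  · ring
  · ring
  all_goals module

theorem jordan_smul_left (c : ℝ) (X Y : J1) : jordan (c • X) Y = c • jordan X Y := by
  apply J1_ext <;> simp only [jordan, h1_fst_zero, h1_fst_one, h1_fst_two, h1_snd_zero,
    h1_snd_one, h1_snd_two, Prod.smul_fst, Prod.smul_snd, Pi.smul_apply, octInner_smul_left,
    octMul_smul_left, octMul_smul_right, octConj_smul, smul_eq_mul]
  · ring
  · ring
  · ring
  all_goals module

theorem jordan_add_right (X Y Z : J1) : jordan X (Y + Z) = jordan X Y + jordan X Z := by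
  simp only [jordan_comm X, jordan_add_left]

theorem jordan_smul_right (c : ℝ) (X Y : J1) : jordan X (c • Y) = c • jordan X Y := by
  simp only [jordan_comm X, jordan_smul_left]

/-- The Jordan product as a continuous bilinear map. -/
def jordanL : J1 →L[ℝ] J1 →L[ℝ] J1 :=
  (LinearMap.mk₂ ℝ jordan jordan_add_left jordan_smul_left jordan_add_right
    jordan_smul_right).toContinuousBilinearMap

theorem jordanL_apply (X Y : J1) : jordanL X Y = jordan X Y := rfl

theorem inn_E1_left (X : J1) : inn E1 X = X.1 0 := by
  simp [inn, tr, jordan, E1, octInner_zero_left]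

theorem inn_E2_right (X : J1) : inn X E2 = X.1 1 := by
  simp [inn, tr, jordan, E2, octInner_zero_right]

/-! ### Null elements -/

theorem jordan_self_fst_zero (X : J1) : (jordan X X).1 0 =
    X.1 0 ^ 2 - octInner (X.2 1) (X.2 1) - octInner (X.2 2) (X.2 2) := by
  simp [jordan]; ring

theorem jordan_self_fst_one (X : J1) : (jordan X X).1 1 =
    X.1 1 ^ 2 + octInner (X.2 0) (X.2 0) - octInner (X.2 2) (X.2 2) := by
  simp [jordan]; ring

theorem jordan_self_fst_two (X : J1) : (jordan X X).1 2 =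
    X.1 2 ^ 2 + octInner (X.2 0) (X.2 0) - octInner (X.2 1) (X.2 1) := by
  simp [jordan]; ring

theorem jordan_self_snd_zero (X : J1) : (jordan X X).2 0 =
    (X.1 1 + X.1 2) • X.2 0 - octConj (octMul (X.2 1) (X.2 2)) := by
  simp only [jordan, h1_snd_zero]; module

theorem jordan_self_snd_one (X : J1) : (jordan X X).2 1 =
    (X.1 2 + X.1 0) • X.2 1 + octConj (octMul (X.2 2) (X.2 0)) := by
  simp only [jordan, h1_snd_one]; module

theorem jordan_self_snd_two (X : J1) : (jordan X X).2 2 =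
    (X.1 0 + X.1 1) • X.2 2 + octConj (octMul (X.2 0) (X.2 1)) := by
  simp only [jordan, h1_snd_two]; module

/-- The first diagonal entry reads `ξ₁² = |x₂|² + |x₃|²`, so `x₂` and `x₃` vanish, and the other two
entries become sums of squares. This keeps `ξ₁` from changing sign along a path of nonzero null
elements. -/
theorem eq_zero_of_jordan_self_eq_zero {X : J1} (h : jordan X X = 0) (h0 : X.1 0 = 0) :
    X = 0 := by
  have e0 : (jordan X X).1 0 = 0 := by rw [h]; rfl
  have e1 : (jordan X X).1 1 = 0 := by rw [h]; rfl
  have e2 : (jordan X X).1 2 = 0 := by rw [h]; rfl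
  rw [jordan_self_fst_zero] at e0
  rw [jordan_self_fst_one] at e1
  rw [jordan_self_fst_two] at e2
  have n0 := octInner_self_nonneg (X.2 0)
  have n1 := octInner_self_nonneg (X.2 1)
  have n2 := octInner_self_nonneg (X.2 2)
  have s1 := sq_nonneg (X.1 1)
  have s2 := sq_nonneg (X.1 2)
  rw [h0] at e0
  refine J1_ext h0 ?_ ?_ ?_ ?_ ?_
  · exact pow_eq_zero_iff two_ne_zero |>.1 (by linarith)
  · exact pow_eq_zero_iff two_ne_zero |>.1 (by linarith)
  · exact octInner_self_eq_zero.1 (by linarith)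
  · exact octInner_self_eq_zero.1 (by linarith)
  · exact octInner_self_eq_zero.1 (by linarith)

/-- Pairing the off-diagonal entries of `X ∘ X` with the `x_i` brings in only the norms and one
cyclic trilinear form `Re (x₁x₂x₃)`, so the claim becomes real algebra in the `ξ_i`, the norms and
this number. -/
theorem tr_eq_zero_of_jordan_self_eq_zero {X : J1} (h : jordan X X = 0) : tr X = 0 := by
  have e0 : (jordan X X).1 0 = 0 := by rw [h]; rfl
  have e1 : (jordan X X).1 1 = 0 := by rw [h]; rfl
  have e2 : (jordan X X).1 2 = 0 := by rw [h]; rfl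
  have f0 : octInner ((jordan X X).2 0) (X.2 0) = 0 := by rw [h]; exact octInner_zero_left _
  have f1 : octInner ((jordan X X).2 1) (X.2 1) = 0 := by rw [h]; exact octInner_zero_left _
  have f2 : octInner ((jordan X X).2 2) (X.2 2) = 0 := by rw [h]; exact octInner_zero_left _
  rw [jordan_self_fst_zero] at e0
  rw [jordan_self_fst_one] at e1
  rw [jordan_self_fst_two] at e2
  rw [jordan_self_snd_zero, sub_eq_add_neg, octInner_add_left, octInner_smul_left,
    octInner_neg_left, octInner_conj_mul_cyclic] at f0
  rw [jordan_self_snd_one, octInner_add_left, octInner_smul_left] at f1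
  rw [jordan_self_snd_two, octInner_add_left, octInner_smul_left,
    octInner_conj_mul_cyclic, octInner_conj_mul_cyclic] at f2
  have n0 := octInner_self_nonneg (X.2 0)
  have n1 := octInner_self_nonneg (X.2 1)
  have n2 := octInner_self_nonneg (X.2 2)
  unfold tr
  generalize octInner (X.2 0) (X.2 0) = a at *
  generalize octInner (X.2 1) (X.2 1) = b at *
  generalize octInner (X.2 2) (X.2 2) = c at *
  generalize octInner (octConj (octMul (X.2 2) (X.2 0))) (X.2 1) = d at *
  generalize X.1 0 = x at *
  generalize X.1 1 = y at *
  generalize X.1 2 = z at *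
  have hb : b = z ^ 2 + a := by linarith
  have hc : c = y ^ 2 + a := by linarith
  subst hb hc
  have ha : a = (x ^ 2 - y ^ 2 - z ^ 2) / 2 := by linarith
  subst ha
  have hd : d = (y + z) * ((x ^ 2 - y ^ 2 - z ^ 2) / 2) := by linarith
  subst hd
  -- After elimination the remaining equations are `(ξ₁ - ξ_j)(tr X)² = 0`. A nonzero trace makes
  -- the `ξ_i` equal, and then `|x₁|² = -ξ₁²/2` forces `ξ₁ = 0`.
  by_contra ht
  have hxy : x = y := by
    have : (x - y) * (x + y + z) ^ 2 = 0 := by linear_combination 2 * f1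
    simpa [ht, sub_eq_zero] using this
  have hxz : x = z := by
    have : (x - z) * (x + y + z) ^ 2 = 0 := by linear_combination 2 * f2
    simpa [ht, sub_eq_zero] using this
  subst hxy hxz
  have : x = 0 := by nlinarith
  simp [this] at ht

theorem mem_N1minus_iff {X : J1} : X ∈ N1minus ↔ jordan X X = 0 ∧ X.1 0 < 0 := by
  rw [← inn_E1_left]
  constructor
  · rintro ⟨h, ht, hE⟩
    refine ⟨?_, hE⟩
    rw [cross, smul_eq_zero, ht] at h
    replace h := h.resolve_left (by norm_num)
    -- The trace of `2 X ∘ X - (X|X) E` is `2 (X|X) - 3 (X|X)`, so `(X|X) = 0` and then `X ∘ X = 0`.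
    have hi : tr ((2 : ℝ) • jordan X X - (0 : ℝ) • X - (0 : ℝ) • X
        + (0 * 0 - inn X X) • unitE) = 0 := by rw [h]; simp [tr]
    have hj : inn X X = 0 := by
      have : tr (jordan X X) = inn X X := rfl
      simp [tr, unitE] at hi this
      linarith
    simpa [hj] using h
  · rintro ⟨h, hE⟩
    have hi : inn X X = 0 := by rw [inn, h]; simp [tr]
    exact ⟨by rw [cross, h, tr_eq_zero_of_jordan_self_eq_zero h, hi]; simp,
      tr_eq_zero_of_jordan_self_eq_zero h, hE⟩

/-- Coordinate relations on the null cone. -/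
theorem N1minus_relations {X : J1} (hX : X ∈ N1minus) :
    X.1 0 * X.1 1 = -octInner (X.2 2) (X.2 2) ∧ X.1 0 * X.1 2 = -octInner (X.2 1) (X.2 1) ∧
    X.1 1 * X.1 2 = octInner (X.2 0) (X.2 0) ∧ X.1 0 + X.1 1 + X.1 2 = 0 ∧
    X.1 1 • X.2 1 = octConj (octMul (X.2 2) (X.2 0)) := by
  have h := (mem_N1minus_iff.1 hX).1
  have ht : X.1 0 + X.1 1 + X.1 2 = 0 := hX.2.1
  have e0 : (jordan X X).1 0 = 0 := by rw [h]; rfl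
  have e1 : (jordan X X).1 1 = 0 := by rw [h]; rfl
  have e2 : (jordan X X).1 2 = 0 := by rw [h]; rfl
  have f1 : (jordan X X).2 1 = 0 := by rw [h]; rfl
  rw [jordan_self_fst_zero] at e0
  rw [jordan_self_fst_one] at e1
  rw [jordan_self_fst_two] at e2
  rw [jordan_self_snd_one] at f1
  have h0 : X.1 0 = -X.1 1 - X.1 2 := by linarith
  rw [h0] at e0
  refine ⟨?_, ?_, ?_, ht, ?_⟩
  · rw [h0]; nlinarith
  · rw [h0]; nlinarith
  · nlinarith
  · rw [eq_comm, ← sub_eq_zero, ← f1, h0]; module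

theorem N1minus_fst_one_nonneg {X : J1} (hX : X ∈ N1minus) : 0 ≤ X.1 1 := by
  have h := (N1minus_relations hX).1
  have h0 := (mem_N1minus_iff.1 hX).2
  have := octInner_self_nonneg (X.2 2)
  by_contra! hc
  nlinarith

/-! ### Derivations and one-parameter groups -/

/-- Derivations of the Jordan product. -/
def IsDer (D : J1 →L[ℝ] J1) : Prop :=
  ∀ X Y, D (jordan X Y) = jordan (D X) Y + jordan X (D Y)

theorem IsDer.add {D D' : J1 →L[ℝ] J1} (h : IsDer D) (h' : IsDer D') : IsDer (D + D') := by
  intro X Y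
  simp only [add_apply, h X Y, h' X Y, jordan_add_left, jordan_add_right]
  abel

theorem IsDer.smul {D : J1 →L[ℝ] J1} (h : IsDer D) (c : ℝ) : IsDer (c • D) := by
  intro X Y
  simp only [smul_apply, h X Y, jordan_smul_left, jordan_smul_right,
    smul_add]

theorem lie_apply_apply (D D' : J1 →L[ℝ] J1) (X : J1) : ⁅D, D'⁆ X = D (D' X) - D' (D X) := rfl

theorem IsDer.lie {D D' : J1 →L[ℝ] J1} (h : IsDer D) (h' : IsDer D') : IsDer ⁅D, D'⁆ := by
  intro X Y
  have hs (X Y Z : J1) : jordan (X - Y) Z = jordan X Z - jordan Y Z := by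
    exact jordanL.map_sub₂ X Y Z
  have hs' (X Y Z : J1) : jordan X (Y - Z) = jordan X Y - jordan X Z := by
    exact map_sub (jordanL X) Y Z
  simp only [lie_apply_apply, h X Y, h' X Y, map_add, h _ _, h' _ _, hs, hs']
  abel

/-- Polarization: the Jordan product is commutative, so squares suffice. -/
theorem isDer_of_self {D : J1 →L[ℝ] J1}
    (h : ∀ X, D (jordan X X) = (2 : ℝ) • jordan (D X) X) : IsDer D := by
  intro X Y
  have h1 := h (X + Y)
  simp only [jordan_add_left, jordan_add_right, map_add, h X, h Y, smul_add,
    jordan_comm Y X, jordan_comm (D Y) X] at h1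
  have h2 : (2 : ℝ) • D (jordan X Y) = (2 : ℝ) • (jordan (D X) Y + jordan X (D Y)) := by
    have := sub_eq_zero.2 h1
    rw [← sub_eq_zero, ← this]
    module
  exact smul_right_injective _ two_ne_zero h2

theorem exp_apply_hasDerivAt (D : J1 →L[ℝ] J1) (X : J1) (t : ℝ) :
    HasDerivAt (fun s : ℝ => NormedSpace.exp (s • D) X) (D (NormedSpace.exp (t • D) X)) t := by
  have h := (hasDerivAt_exp_smul_const' (𝕂 := ℝ) D t).clm_apply (hasDerivAt_const t X)
  simpa using h

theorem exp_neg_mul_exp (D : J1 →L[ℝ] J1) :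
    NormedSpace.exp (-D) * NormedSpace.exp D = 1 := by
  let : NormedAlgebra ℚ (J1 →L[ℝ] J1) := NormedAlgebra.restrictScalars ℚ ℝ (J1 →L[ℝ] J1)
  rw [← NormedSpace.exp_add_of_commute (Commute.neg_left (Commute.refl D)), neg_add_cancel,
    NormedSpace.exp_zero]

theorem exp_mul_exp_neg (D : J1 →L[ℝ] J1) :
    NormedSpace.exp D * NormedSpace.exp (-D) = 1 := by
  simpa using exp_neg_mul_exp (-D)

/-- Uniqueness of the solutions of `γ' = D γ`. -/
theorem eq_exp_apply {D : J1 →L[ℝ] J1} {γ : ℝ → J1} (h : ∀ t, HasDerivAt γ (D (γ t)) t) (t : ℝ) :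
    γ t = NormedSpace.exp (t • D) (γ 0) := by
  have hd : ∀ s : ℝ, HasDerivAt (fun s : ℝ => NormedSpace.exp (s • -D) (γ s)) 0 s := by
    intro s
    have h1 := (hasDerivAt_exp_smul_const (𝕂 := ℝ) (-D) s).clm_apply (h s)
    simpa using h1
  have hc := is_const_of_deriv_eq_zero (fun s => (hd s).differentiableAt)
    (fun s => (hd s).deriv) t 0
  simp only [zero_smul, smul_neg, neg_zero, NormedSpace.exp_zero, one_apply_eq_self] at hc
  rw [← hc, ← mul_apply_eq_comp, exp_mul_exp_neg, one_apply_eq_self]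

theorem exp_apply_of_apply_eq_zero {D : J1 →L[ℝ] J1} {X : J1} (h : D X = 0) (t : ℝ) :
    NormedSpace.exp (t • D) X = X := by
  refine (eq_exp_apply (γ := fun _ => X) (fun s => ?_) t).symm
  rw [h]
  exact hasDerivAt_const s X

/-- By the Leibniz rule the right side also solves `γ' = D γ`, with the same initial value. -/
theorem IsDer.exp {D : J1 →L[ℝ] J1} (h : IsDer D) (t : ℝ) (X Y : J1) :
    NormedSpace.exp (t • D) (jordan X Y) =
      jordan (NormedSpace.exp (t • D) X) (NormedSpace.exp (t • D) Y) := by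
  have := eq_exp_apply (D := D)
    (γ := fun s => jordan (NormedSpace.exp (s • D) X) (NormedSpace.exp (s • D) Y)) (fun s => ?_) t
  · simpa using this.symm
  · rw [h]
    exact (jordanL.hasFDerivAt.comp_hasDerivAt s (exp_apply_hasDerivAt D X s)).clm_apply
      (exp_apply_hasDerivAt D Y s)

/-- The exponential as an element of the linear group. -/
def expGL (D : J1 →L[ℝ] J1) : GLJ :=
  ContinuousLinearEquiv.equivOfInverse (NormedSpace.exp D) (NormedSpace.exp (-D))
    (fun X => DFunLike.congr_fun (exp_neg_mul_exp D) X)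
    (fun X => DFunLike.congr_fun (exp_mul_exp_neg D) X)

theorem IsDer.mem_f4 {D : J1 →L[ℝ] J1} (h : IsDer D) : D ∈ f4 :=
  fun t => ⟨expGL (t • D), h.exp t, rfl⟩

/-- Differentiate the automorphism identity for `exp (tD)` at `t = 0`. -/
theorem isDer_of_mem_f4 {D : J1 →L[ℝ] J1} (h : D ∈ f4) : IsDer D := by
  intro X Y
  have h1 : ∀ t : ℝ, NormedSpace.exp (t • D) (jordan X Y) =
      jordan (NormedSpace.exp (t • D) X) (NormedSpace.exp (t • D) Y) := by
    intro t
    obtain ⟨g, hg, hgt⟩ := h t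
    rw [← hgt]
    exact hg X Y
  have h2 := exp_apply_hasDerivAt D (jordan X Y) 0
  have h3 := (jordanL.hasFDerivAt.comp_hasDerivAt 0 (exp_apply_hasDerivAt D X 0)).clm_apply
      (exp_apply_hasDerivAt D Y 0)
  have h4 := h2.unique (h3.congr_of_eventuallyEq (Filter.Eventually.of_forall h1))
  simpa [jordanL_apply] using h4

/-! ### The group fixing `E₂` -/

theorem F4_jordan_self {g : GLJ} (hg : g ∈ F4) (X : J1) :
    jordan (g X) (g X) = 0 ↔ jordan X X = 0 := by
  rw [← hg X X, map_eq_zero_iff _ g.injective]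

/-- Multiplication by a primitive idempotent has eigenvalues `0`, `1/2`, `1`; the polynomial `2s² -
s` vanishes at the first two and is `1` at the last, so it gives the projection onto the line of the
idempotent. -/
theorem peirce_E1 (X : J1) :
    (2 : ℝ) • jordan E1 (jordan E1 X) - jordan E1 X = X.1 0 • E1 := by
  apply J1_ext <;> simp [jordan, E1, octInner_zero_left, octMul_zero_left, octMul_zero_right,
    octConj_zero]
  ring

theorem peirce_E2 (X : J1) :
    (2 : ℝ) • jordan E2 (jordan E2 X) - jordan E2 X = X.1 1 • E2 := by
  apply J1_ext <;> simp [jordan, E2, octInner_zero_left, octMul_zero_left, octMul_zero_right,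
    octConj_zero]
  ring

theorem fst_zero_of_fix {g : GLJ} (hg : g ∈ F4) (h : g E1 = E1) (X : J1) :
    (g X).1 0 = X.1 0 := by
  have h1 := congrArg g (peirce_E1 X)
  rw [map_sub, map_smul, map_smul, hg, hg, h, peirce_E1] at h1
  simpa [E1] using congrArg (fun Y : J1 => Y.1 0) h1

theorem fst_one_of_fix {g : GLJ} (hg : g ∈ F4) (h : g E2 = E2) (X : J1) :
    (g X).1 1 = X.1 1 := by
  have h1 := congrArg g (peirce_E2 X)
  rw [map_sub, map_smul, map_smul, hg, hg, h, peirce_E2] at h1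
  simpa [E2] using congrArg (fun Y : J1 => Y.1 1) h1

/-- The automorphisms fixing `E₂` and preserving the exceptional null cone. -/
def stabE2 : Subgroup GLJ where
  carrier := {g | g ∈ F4 ∧ g E2 = E2 ∧ ∀ X, g X ∈ N1minus ↔ X ∈ N1minus}
  mul_mem' := by
    rintro a b ⟨ha, ha', ha''⟩ ⟨hb, hb', hb''⟩
    refine ⟨mul_mem ha hb, ?_, fun X => ?_⟩
    · change a (b E2) = E2
      rw [hb', ha']
    · change a (b X) ∈ N1minus ↔ _
      rw [ha'', hb'']
  one_mem' := ⟨one_mem _, rfl, fun _ => Iff.rfl⟩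
  inv_mem' := by
    rintro a ⟨ha, ha', ha''⟩
    have key : ∀ Z, a ((a⁻¹ : GLJ) Z) = Z := fun Z => a.apply_symm_apply Z
    refine ⟨inv_mem ha, ?_, fun X => ?_⟩
    · apply a.injective
      rw [key, ha']
    · rw [← ha'', key]

/-- The path `exp (tD) X` consists of nonzero null elements, whose `ξ₁` never vanishes; by the
intermediate value theorem its sign is constant. -/
theorem exp_mem_stabE2 {D : J1 →L[ℝ] J1} (h : IsDer D) (h2 : D E2 = 0) {g : GLJ}
    (hg : (g : J1 →L[ℝ] J1) = NormedSpace.exp D) : g ∈ stabE2 := by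
  have hgX : ∀ X, g X = NormedSpace.exp ((1 : ℝ) • D) X := by
    intro X
    rw [one_smul, ← hg]
    rfl
  have hgF : g ∈ F4 := fun X Y => by rw [hgX, hgX, hgX, h.exp]
  refine ⟨hgF, ?_, fun X => ?_⟩
  · rw [hgX, exp_apply_of_apply_eq_zero h2]
  rw [mem_N1minus_iff, mem_N1minus_iff, F4_jordan_self hgF, and_congr_right_iff]
  intro hX
  rcases eq_or_ne X 0 with rfl | hX0
  · simp
  have hcont : Continuous fun t : ℝ => (NormedSpace.exp (t • D) X).1 0 := by
    have : Continuous fun t : ℝ => NormedSpace.exp (t • D) X :=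
      continuous_iff_continuousAt.2 fun t => (exp_apply_hasDerivAt D X t).continuousAt
    fun_prop
  have hne : ∀ t : ℝ, (NormedSpace.exp (t • D) X).1 0 ≠ 0 := by
    intro t ht
    have hF : expGL (t • D) ∈ F4 := h.exp t
    have h0 : expGL (t • D) X = 0 :=
      eq_zero_of_jordan_self_eq_zero ((F4_jordan_self hF X).2 hX) ht
    exact hX0 ((map_eq_zero_iff _ (expGL (t • D)).injective).1 h0)
  have e0 : X.1 0 = (NormedSpace.exp ((0 : ℝ) • D) X).1 0 := by simp
  rw [hgX, e0]
  constructor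
  · intro h1
    by_contra! h0
    obtain ⟨t, -, ht⟩ := intermediate_value_Icc' zero_le_one hcont.continuousOn ⟨h1.le, h0⟩
    exact hne t ht
  · intro h0
    by_contra! h1
    obtain ⟨t, -, ht⟩ := intermediate_value_Icc zero_le_one hcont.continuousOn ⟨h0.le, h1⟩
    exact hne t ht

theorem mem_stabE2_of_fix {g : GLJ} (hg : g ∈ F4) (h1 : g E1 = E1) (h2 : g E2 = E2) :
    g ∈ stabE2 := by
  refine ⟨hg, h2, fun X => ?_⟩
  rw [mem_N1minus_iff, mem_N1minus_iff, F4_jordan_self hg, fst_zero_of_fix hg h1]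

/-! ### Elements of `K` and `M` fix idempotents -/

theorem A31_apply (X : J1) : A31 X =
    h1 (-2 * octInner octOne (X.2 2)) (2 * octInner octOne (X.2 2)) 0
      (octConj (X.2 1)) (octConj (X.2 0)) ((X.1 1 - X.1 0) • octOne) := rfl

theorem sigma_apply (X : J1) :
    sigma X = h1 (X.1 0) (X.1 1) (X.1 2) (X.2 0) (-X.2 1) (-X.2 2) := rfl

theorem theta_apply (D : J1 →L[ℝ] J1) (X : J1) : theta D X = sigma (D (sigma X)) := rfl

theorem sigma_E1 : sigma E1 = E1 := by
  apply J1_ext <;> simp [sigma_apply, E1]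

theorem sigma_E2 : sigma E2 = E2 := by
  apply J1_ext <;> simp [sigma_apply, E2]

theorem snd_eq_zero_of_sigma_eq {X : J1} (h : sigma X = X) : X.2 1 = 0 ∧ X.2 2 = 0 := by
  rw [sigma_apply] at h
  exact ⟨self_eq_neg.1 (congrArg (fun Y : J1 => Y.2 1) h).symm,
    self_eq_neg.1 (congrArg (fun Y : J1 => Y.2 2) h).symm⟩

/-- The `-1` eigenspace of `σ` is the Peirce `1/2`-space of `E₁`, and `g` preserves it. So `g E₁` is
a `σ`-fixed idempotent acting as `1/2` there, which leaves only `E₁` and `E₂ + E₃`. -/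
theorem K_fix_E1 {g : GLJ} (hg : g ∈ K) : g E1 = E1 := by
  obtain ⟨hF, hs⟩ := hg
  have hc : ∀ X, sigma (g X) = g (sigma X) := fun X =>
    DFunLike.congr_fun (Subgroup.mem_centralizer_iff.1 hs sigma rfl) X
  have hgs : ∀ X, g ((g⁻¹ : GLJ) X) = X := fun Z => g.apply_symm_apply Z
  have hA := snd_eq_zero_of_sigma_eq (X := g E1) (by rw [hc, sigma_E1])
  have hY : ∀ Y, sigma Y = -Y → jordan (g E1) Y = (1 / 2 : ℝ) • Y := by
    intro Y hY
    have h1 : sigma ((g⁻¹ : GLJ) Y) = -(g⁻¹ : GLJ) Y := by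
      apply g.injective
      rw [← hc, map_neg, hgs, hY]
    have h2 : jordan E1 ((g⁻¹ : GLJ) Y) = (1 / 2 : ℝ) • (g⁻¹ : GLJ) Y := by
      generalize (g⁻¹ : GLJ) Y = Z at h1
      rw [sigma_apply] at h1
      have e (f : J1 → ℝ) := congrArg f h1
      have a := self_eq_neg.1 (e fun Y => Y.1 0)
      have b := self_eq_neg.1 (e fun Y => Y.1 1)
      have c := self_eq_neg.1 (e fun Y => Y.1 2)
      have d := self_eq_neg.1 (congrArg (fun Y : J1 => Y.2 0) h1)
      simp only [h1_fst_zero, h1_fst_one, h1_fst_two, h1_snd_zero] at a b c d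
      apply J1_ext <;> simp [jordan, E1, octInner_zero_left, octMul_zero_left,
        octMul_zero_right, octConj_zero, a, b, c, d]
    have h3 := congrArg g h2
    rwa [hF, hgs, map_smul, hgs] at h3
  have h2 := hY (h1 0 0 0 0 octOne 0) (by apply J1_ext <;> simp [sigma_apply])
  have h3 := hY (h1 0 0 0 0 0 octOne) (by apply J1_ext <;> simp [sigma_apply])
  have hI : jordan (g E1) (g E1) = g E1 := by
    rw [← hF]
    congr 1
    apply J1_ext <;> simp [jordan, E1, octInner_zero_left, octMul_zero_left, octConj_zero]
  have h12 : jordan (g E1) (g E2) = 0 := by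
    rw [← hF, ← map_zero g]
    congr 1
    apply J1_ext <;> simp [jordan, E1, E2, octInner_zero_left, octMul_zero_left, octConj_zero]
  have h13 : jordan (g E1) (g (h1 0 0 1 0 0 0)) = 0 := by
    rw [← hF, ← map_zero g]
    congr 1
    apply J1_ext <;> simp [jordan, E1, octInner_zero_left, octMul_zero_left, octConj_zero]
  have hx : (g E1).2 0 = 0 := by
    have := congrArg (fun Y : J1 => Y.2 2) h2
    simp only [jordan, h1_snd_zero, h1_snd_one, h1_snd_two, h1_fst_zero, h1_fst_one,
      octMul_one, octMul_zero_left, octConj_zero, hA.2, smul_zero, zero_add, add_zero,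
      Prod.smul_snd, Pi.smul_apply] at this
    rw [← octConj_octConj ((g E1).2 0), (smul_eq_zero.1 this).resolve_left (by norm_num),
      octConj_zero]
  have ha := congrArg (fun Y : J1 => Y.2 1 0) h2
  have hb := congrArg (fun Y : J1 => Y.2 2 0) h3
  have hi := congrArg (fun Y : J1 => Y.1 0) hI
  simp [jordan, hA, hx, octMul_zero_left, octMul_zero_right, octConj_zero, octOne_eq] at ha hb
  simp only [jordan, h1_fst_zero, hA, octInner_zero_left, sub_zero] at hi
  have hi' : ((g E1).1 0 - 1) * (g E1).1 0 = 0 := by linarith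
  rcases mul_eq_zero.1 hi' with hi | hi
  · replace hi := sub_eq_zero.1 hi
    refine J1_ext hi ?_ ?_ hx hA.1 hA.2
    · change _ = (0 : ℝ)
      linarith
    · change _ = (0 : ℝ)
      linarith
  -- The remaining candidate `E₂ + E₃` annihilates only the line `ℝE₁`, whereas `g E₁` annihilates
  -- the independent elements `g E₂` and `g E₃`.
  exfalso
  have hb' : (g E1).1 1 = 1 := by linarith
  have ha' : (g E1).1 2 = 1 := by linarith
  have hA' : g E1 = h1 0 1 1 0 0 0 := by
    apply J1_ext <;> simp [hA, hx, ha', hb', hi]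
  have hz : ∀ Z, jordan (g E1) Z = 0 → Z = Z.1 0 • E1 := by
    intro Z hZ
    rw [hA'] at hZ
    have e1 := congrArg (fun Y : J1 => Y.1 1) hZ
    have e2 := congrArg (fun Y : J1 => Y.1 2) hZ
    have f0 := congrArg (fun Y : J1 => Y.2 0) hZ
    have f1 := congrArg (fun Y : J1 => Y.2 1) hZ
    have f2 := congrArg (fun Y : J1 => Y.2 2) hZ
    simp [jordan, octInner_zero_left, octMul_zero_left, octMul_zero_right, octConj_zero]
      at e1 e2 f0 f1 f2
    have f0' : Z.2 0 = 0 := by simpa [← two_smul ℝ (2⁻¹ : ℝ), ← add_smul] using f0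
    apply J1_ext <;> simp [E1, e1, e2, f0', f1, f2]
  have k2 := hz _ h12
  have k3 := hz _ h13
  generalize (g E2).1 0 = s at k2
  generalize (g (h1 0 0 1 0 0 0)).1 0 = r at k3
  have hk : g (r • E2 - s • h1 0 0 1 0 0 0) = 0 := by
    rw [map_sub, map_smul, map_smul, k2, k3, smul_smul, smul_smul, mul_comm, sub_self]
  rw [map_eq_zero_iff _ g.injective] at hk
  have hr := congrArg (fun Y : J1 => Y.1 1) hk
  have hs' := congrArg (fun Y : J1 => Y.1 2) hk
  simp [E2] at hr hs'
  rw [hs', zero_smul, map_eq_zero_iff _ g.injective] at k2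
  simpa [E2] using congrArg (fun Y : J1 => Y.1 1) k2

theorem A31_h1 (a b c : ℝ) (x y z : Oct ℝ) : A31 (h1 a b c x y z) =
    h1 (-2 * z 0) (2 * z 0) 0 (octConj y) (octConj x) ((b - a) • octOne) := by
  rw [A31_apply, octInner_one_left]
  rfl

theorem octOne_zero : (octOne : Oct ℝ) 0 = 1 := rfl

theorem A31_E1 : A31 E1 = h1 0 0 0 0 0 (-octOne) := by
  apply J1_ext <;> simp [A31_apply, E1, octConj_zero, octInner_zero_right]

theorem A31_E2 : A31 E2 = h1 0 0 0 0 0 octOne := by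
  apply J1_ext <;> simp [A31_apply, E2, octConj_zero, octInner_zero_right]

/-- Whatever fixes `E₁` and commutes with the generator of `𝔞` therefore fixes `E₂`; likewise for
derivations killing `E₁`. -/
theorem E2_eq : E2 = E1 - (1 / 2 : ℝ) • A31 (A31 E1) := by
  rw [A31_E1, A31_h1]
  apply J1_ext <;> simp [E1, E2, octConj_zero, octOne_zero]

theorem M_le_stabE2 {m : GLJ} (hm : m ∈ M) : m ∈ stabE2 := by
  obtain ⟨hK, hA⟩ := hm
  have h1 := K_fix_E1 hK
  have hc : ∀ X, m (A31 X) = A31 (m X) := by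
    intro X
    conv_rhs => rw [← hA]
    change _ = m (A31 ((m⁻¹ * m : GLJ) X))
    rw [inv_mul_cancel]
    rfl
  refine mem_stabE2_of_fix hK.1 h1 ?_
  rw [E2_eq, map_sub, map_smul, hc, hc, h1]

/-! ### Elements of `𝔨_ε` annihilate `E₂` -/

/-- Differentiating `E_i ∘ E_i = E_i` puts `D E_i` in the Peirce `1/2`-space of `E_i`;
differentiating `E₁ ∘ E₂ = 0` makes the two `x₃` entries opposite. -/
theorem IsDer.apply_E1_E2 {D : J1 →L[ℝ] J1} (h : IsDer D) :
    ∃ a b c, D E1 = h1 0 0 0 0 b c ∧ D E2 = h1 0 0 0 a 0 (-c) := by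
  have e11 : jordan E1 E1 = E1 := by
    apply J1_ext <;> simp [jordan, E1, octInner_zero_left, octMul_zero_left, octConj_zero]
  have e22 : jordan E2 E2 = E2 := by
    apply J1_ext <;> simp [jordan, E2, octInner_zero_left, octMul_zero_left, octConj_zero]
  have e12 : jordan E1 E2 = 0 := by
    apply J1_ext <;> simp [jordan, E1, E2, octInner_zero_left, octMul_zero_left, octConj_zero]
  have d1 := h E1 E1
  have d2 := h E2 E2
  have d3 := h E1 E2
  rw [e11, jordan_comm E1, ← two_smul ℝ] at d1
  rw [e22, jordan_comm E2, ← two_smul ℝ] at d2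
  rw [e12, map_zero] at d3
  generalize D E1 = X at d1 d3
  generalize D E2 = Y at d2 d3
  have a0 := congrArg (fun Y : J1 => Y.1 0) d1
  have a1 := congrArg (fun Y : J1 => Y.1 1) d1
  have a2 := congrArg (fun Y : J1 => Y.1 2) d1
  have x0 := congrArg (fun Y : J1 => Y.2 0) d1
  have b0 := congrArg (fun Y : J1 => Y.1 0) d2
  have b1 := congrArg (fun Y : J1 => Y.1 1) d2
  have b2 := congrArg (fun Y : J1 => Y.1 2) d2
  have y0 := congrArg (fun Y : J1 => Y.2 1) d2
  have z := congrArg (fun Y : J1 => Y.2 2) d3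
  simp [jordan, E1, octInner_zero_right, octMul_zero_left,
    octMul_zero_right, octConj_zero] at a0 a1 a2 x0
  simp [jordan, E2, octInner_zero_right, octMul_zero_left,
    octMul_zero_right, octConj_zero] at b0 b1 b2 y0
  simp [jordan, E1, E2, octMul_zero_left, octMul_zero_right, octConj_zero] at z
  have z' : Y.2 2 = -X.2 2 := by
    rw [eq_neg_iff_add_eq_zero, add_comm]
    have : (2⁻¹ : ℝ) • (X.2 2 + Y.2 2) = 0 := by rw [smul_add, ← z]
    exact (smul_eq_zero.1 this).resolve_left (by norm_num)
  refine ⟨Y.2 0, X.2 1, X.2 2, ?_, ?_⟩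
  · apply J1_ext <;> simp [a1, a2, x0]
    linarith
  · apply J1_ext <;> simp [b0, b2, y0, z']
    linarith

theorem theta_A31 : theta A31 = -A31 := by
  refine ContinuousLinearMap.ext fun X => ?_
  rw [theta_apply, neg_apply]
  apply J1_ext <;> simp [sigma_apply, A31_apply, octConj_neg, octInner_neg_right]

theorem theta_theta (D : J1 →L[ℝ] J1) : theta (theta D) = D := by
  have h : ∀ X, sigma (sigma X) = X := fun X => by
    apply J1_ext <;> simp [sigma_apply]
  refine ContinuousLinearMap.ext fun X => ?_
  rw [theta_apply, theta_apply, h, h]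

theorem theta_lie_A31 (D : J1 →L[ℝ] J1) : theta ⁅A31, D⁆ = -⁅A31, theta D⁆ := by
  have : theta ⁅A31, D⁆ = ⁅theta A31, theta D⁆ := Ad_lie sigma _ _
  rw [this, theta_A31]
  refine ContinuousLinearMap.ext fun X => ?_
  simp only [neg_apply, lie_apply_apply, map_neg]
  abel

theorem E1_of_theta_eq {D : J1 →L[ℝ] J1} (h : IsDer D) (ht : theta D = D) :
    ∃ a, D E1 = 0 ∧ D E2 = h1 0 0 0 a 0 0 := by
  obtain ⟨a, b, c, h1, h2⟩ := h.apply_E1_E2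
  have hs : sigma (D E1) = D E1 := by
    conv_rhs => rw [← ht]
    rw [theta_apply, sigma_E1]
  have := snd_eq_zero_of_sigma_eq hs
  rw [h1] at this
  simp only [h1_snd_one, h1_snd_two] at this
  obtain ⟨rfl, rfl⟩ := this
  refine ⟨a, h1.trans ?_, by rw [h2, neg_zero]⟩
  apply J1_ext <;> simp

theorem mm_apply_E2 {Z : J1 →L[ℝ] J1} (hZ : Z ∈ mm) : Z E2 = 0 := by
  obtain ⟨hf, ht, hc⟩ := hZ
  obtain ⟨a, h1, -⟩ := E1_of_theta_eq (isDer_of_mem_f4 hf) ht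
  have hc' : ∀ X, Z (A31 X) = A31 (Z X) := fun X =>
    sub_eq_zero.1 (DFunLike.congr_fun hc X)
  rw [E2_eq, map_sub, map_smul, hc', hc', h1]
  simp

/-- Evaluate on `E₁ + E₂`, which `Ã₃¹(1)` kills: only `Ã₃¹(1)² W` contributes to `ad² W`, and it
reproduces the `x₁` entry `a` of `W E₂`. So `a = 4a`. -/
theorem apply_E2_of_lie_lie_eq_four {W : J1 →L[ℝ] J1} (h : IsDer W) (ht : theta W = W)
    (hA : ⁅A31, ⁅A31, W⁆⁆ = (4 : ℝ) • W) : W E2 = 0 := by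
  obtain ⟨a, w1, w2⟩ := E1_of_theta_eq h ht
  have e := DFunLike.congr_fun hA (E1 + E2)
  have h0 : A31 (E1 + E2) = 0 := by
    rw [map_add, A31_E1, A31_E2]
    apply J1_ext <;> simp
  have h3 : W (E1 + E2) = h1 0 0 0 a 0 0 := by rw [map_add, w1, w2, zero_add]
  simp only [lie_apply_apply, h0, map_zero, sub_zero, smul_apply, h3, A31_h1] at e
  have e0 := congrArg (fun Y : J1 => Y.2 0) e
  simp only [h1_snd_zero, Prod.smul_snd, Pi.smul_apply, octConj_octConj] at e0
  have ha : (3 : ℝ) • a = 0 := by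
    rw [← sub_eq_zero.2 e0.symm]
    module
  rw [w2, (smul_eq_zero.1 ha).resolve_left (by norm_num)]
  apply J1_ext <;> simp

theorem octConj_eq_sub (x : Oct ℝ) : octConj x = (2 * x 0) • octOne - x := by
  rw [octConj_eq, octOne_eq]
  funext i
  fin_cases i <;> simp
  ring

theorem octMul_sub_left (x y z : Oct ℝ) : octMul (x - y) z = octMul x z - octMul y z := by
  rw [sub_eq_add_neg, octMul_add_left, octMul_neg_left, ← sub_eq_add_neg]

theorem octMul_sub_right (x y z : Oct ℝ) : octMul x (y - z) = octMul x y - octMul x z := by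
  rw [sub_eq_add_neg, octMul_add_right, octMul_neg_right, ← sub_eq_add_neg]

theorem octMul_apply_zero (x y : Oct ℝ) : octMul x y 0 = octInner x (octConj y) := by
  simp only [octInner_eq_sum, octMul_eq, octConj_eq, Fin.sum_univ_eight, Matrix.cons_val]
  ring

theorem octInner_conj_left (x y : Oct ℝ) : octInner (octConj x) y = octInner x (octConj y) := by
  rw [← octInner_conj, octConj_octConj]

theorem octMul_conj_self (x : Oct ℝ) : octMul x (octConj x) = octInner x x • octOne := by
  simpa [one_octMul] using octMul_mul_conj octOne x

theorem octConj_mul_self (x : Oct ℝ) : octMul (octConj x) x = octInner x x • octOne := by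
  simpa [octMul_one] using octMul_conj_mul x octOne

theorem isDer_A31 : IsDer A31 := by
  refine isDer_of_self fun X => ?_
  apply J1_ext <;> simp only [A31_apply, jordan, h1_fst_zero, h1_fst_one, h1_fst_two,
    h1_snd_zero, h1_snd_one, h1_snd_two, octInner_one_left, Prod.smul_fst, Prod.smul_snd,
    Pi.smul_apply, Pi.add_apply, smul_eq_mul, octMul_apply_zero, octInner_conj_left,
    octInner_smul_left, octInner_comm (X.2 1) (octConj (X.2 0)), octConj_add, octConj_sub,
    octConj_smul, octConj_octConj, octConj_octMul, octMul_smul_left, octMul_smul_right,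
    octMul_one, one_octMul, octMul_conj_self, octConj_mul_self, octConj_one]
  · ring
  · ring
  · ring
  · rw [octConj_eq_sub (X.2 2), octMul_sub_left, octMul_smul_left, one_octMul]
    module
  · rw [octConj_eq_sub (X.2 2), octMul_sub_right, octMul_smul_right, octMul_one]
    module
  · module

/-- The bracket `[Ã₃¹(1), W]` is `θ`-fixed, so it kills `E₁`; this determines `W` on the `x₃` unit.
The `x₃` entry of `ad² W = W` at `E₁` then reads `a = 4a - 4 Re(a)`, whose real part gives `Re a =
0` and hence `a = 0`. -/
theorem apply_E2_of_lie_lie_eq_self {W : J1 →L[ℝ] J1} (h : IsDer W) (ht : theta W = -W)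
    (hA : ⁅A31, ⁅A31, W⁆⁆ = W) : W E2 = 0 := by
  obtain ⟨b', b, a, w1, w2⟩ := h.apply_E1_E2
  have hU : theta ⁅A31, W⁆ = ⁅A31, W⁆ := by
    rw [theta_lie_A31, ht]
    refine ContinuousLinearMap.ext fun X => ?_
    simp only [neg_apply, lie_apply_apply, map_neg]
    abel
  obtain ⟨-, u1, -⟩ := E1_of_theta_eq (isDer_A31.lie h) hU
  have hs : sigma (W E2) = -W E2 := by
    rw [← neg_apply, ← ht, theta_apply, sigma_E2]
  have hb' : b' = 0 := by
    rw [w2] at hs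
    exact self_eq_neg.1 (congrArg (fun Y : J1 => Y.2 0) hs)
  have e3 : A31 E1 = -h1 0 0 0 0 0 octOne := by
    rw [A31_E1]
    apply J1_ext <;> simp
  have e4 : A31 (h1 0 0 0 0 0 octOne) = (2 : ℝ) • (E2 - E1) := by
    rw [A31_h1]
    apply J1_ext <;> simp [E1, E2, octConj_zero, octOne_zero]
  have w3 : W (h1 0 0 0 0 0 octOne) = -A31 (W E1) := by
    rw [lie_apply_apply, e3, map_neg, sub_neg_eq_add] at u1
    exact eq_neg_of_add_eq_zero_right u1
  have e := DFunLike.congr_fun hA E1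
  rw [lie_apply_apply, u1, map_zero, zero_sub, e3, map_neg, neg_neg, lie_apply_apply, e4, w3,
    map_smul, map_sub, map_neg, w1, w2, A31_h1, A31_h1] at e
  have e2 := congrArg (fun Y : J1 => Y.2 2) e
  simp only [Prod.snd_sub, Prod.snd_neg, Prod.smul_snd, Pi.sub_apply, Pi.neg_apply,
    Pi.smul_apply, h1_snd_two] at e2
  have e0 := congrFun e2 0
  simp [octOne_zero] at e0
  have ha0 : a 0 = 0 := by linarith
  have ha : (3 : ℝ) • a = 0 := by
    rw [← sub_eq_zero.2 e2, ha0]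
    module
  rw [w2, (smul_eq_zero.1 ha).resolve_left (by norm_num), hb']
  apply J1_ext <;> simp

/-! ### Separating root components by the eigenvalues of `ad Ã₃¹(1)` -/

theorem eq_zero_of_sum_eigenvectors {E : Type*} [AddCommGroup E] [Module ℝ E] (f : E →ₗ[ℝ] E)
    {y₀ y₁ y₂ y₃ y₄ : E} (h₀ : f y₀ = 0) (h₁ : f y₁ = y₁) (h₂ : f y₂ = -y₂)
    (h₃ : f y₃ = (2 : ℝ) • y₃) (h₄ : f y₄ = (-2 : ℝ) • y₄) (h : y₀ + y₁ + y₂ + y₃ + y₄ = 0) :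
    y₂ = 0 ∧ y₄ = 0 ∧ y₀ = 0 := by
  have k1 := congrArg f h
  have k2 := congrArg f k1
  have k3 := congrArg f k2
  have k4 := congrArg f k3
  simp only [map_add, map_zero, map_neg, map_smul, h₀, h₁, h₂, h₃, h₄] at k1 k2 k3 k4
  -- The coefficients here and below are those of the Lagrange polynomials for the nodes `0, ±1,
  -- ±2`.
  have r2 : y₂ = 0 := by
    linear_combination (norm := module) (-2 / 3 : ℝ) • k1 + (2 / 3 : ℝ) • k2
      + (1 / 6 : ℝ) • k3 - (1 / 6 : ℝ) • k4
  have r4 : y₄ = 0 := by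
    linear_combination (norm := module) (1 / 12 : ℝ) • k1 - (1 / 24 : ℝ) • k2
      - (1 / 12 : ℝ) • k3 + (1 / 24 : ℝ) • k4
  refine ⟨r2, r4, ?_⟩
  linear_combination (norm := module) h - (5 / 4 : ℝ) • k2 + (1 / 4 : ℝ) • k4

theorem theta_add (D D' : J1 →L[ℝ] J1) : theta (D + D') = theta D + theta D' := Ad_add _ _ _

theorem theta_smul (c : ℝ) (D : J1 →L[ℝ] J1) : theta (c • D) = c • theta D := Ad_smul _ _ _

theorem lie_of_mem_rootSpace {c : ℤ} {V : J1 →L[ℝ] J1} (h : V ∈ rootSpace c) :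
    ⁅A31, V⁆ = (c : ℝ) • V := by
  simpa using h.2 1

theorem lie_theta_of_mem_rootSpace {c : ℤ} {V : J1 →L[ℝ] J1} (h : V ∈ rootSpace c) :
    ⁅A31, theta V⁆ = -(c : ℝ) • theta V := by
  have h1 := theta_lie_A31 V
  rw [lie_of_mem_rootSpace h, theta_smul] at h1
  rw [← neg_neg ⁅A31, theta V⁆, ← h1]
  module

/-- The operator `ad Ã₃¹(1)`. -/
def adA31 : (J1 →L[ℝ] J1) →ₗ[ℝ] (J1 →L[ℝ] J1) :=
  LinearMap.mulLeft ℝ A31 - LinearMap.mulRight ℝ A31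

theorem adA31_apply (D : J1 →L[ℝ] J1) : adA31 D = ⁅A31, D⁆ := rfl

theorem kEps_isDer_and_apply_E2 {D : J1 →L[ℝ] J1} (h : D ∈ kEps) : IsDer D ∧ D E2 = 0 := by
  obtain ⟨_, ⟨t, rfl⟩, Z, hZ, V, hV, e1, e2⟩ := h
  have hs (W : ℤ → (J1 →L[ℝ] J1)) : ∑ c ∈ roots, W c = W 1 + W (-1) + W 2 + W (-2) := by
    simp [roots, add_assoc]
  have s1 : eps 1 = -1 := by simp [eps]
  have s2 : eps (-1) = -1 := by simp [eps]
  have s3 : eps 2 = 1 := by norm_num [eps]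
  have s4 : eps (-2) = 1 := by norm_num [eps]
  rw [hs] at e1 e2
  rw [theta_add, theta_smul, theta_A31, hZ.2.1, s1, s2, s3, s4] at e2
  have v1 := hV 1 (by simp [roots])
  have v2 := hV (-1) (by simp [roots])
  have v3 := hV 2 (by simp [roots])
  have v4 := hV (-2) (by simp [roots])
  have l1 := lie_of_mem_rootSpace v1
  have l2 := lie_of_mem_rootSpace v2
  have l3 := lie_of_mem_rootSpace v3
  have l4 := lie_of_mem_rootSpace v4
  have m1 := lie_theta_of_mem_rootSpace v1
  have m2 := lie_theta_of_mem_rootSpace v2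
  have m3 := lie_theta_of_mem_rootSpace v3
  have m4 := lie_theta_of_mem_rootSpace v4
  rw [← adA31_apply] at l1 l2 l3 l4 m1 m2 m3 m4
  push_cast at l1 l2 l3 l4 m1 m2 m3 m4
  generalize V 1 = V₁ at *
  generalize V (-1) = V₂ at *
  generalize V 2 = V₃ at *
  generalize V (-2) = V₄ at *
  -- `D - θ_ε D = 0` sorted by eigenvalue, using that `θ` sends the root space of `λ` to that of
  -- `-λ`. The components for `1` and `2` carry no further information, being up to sign the
  -- `θ`-images of those for `-1` and `-2`.
  obtain ⟨k2, k4, k0⟩ := eq_zero_of_sum_eigenvectors adA31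
    (y₀ := (2 * t) • A31) (y₁ := V₁ + theta V₂) (y₂ := V₂ + theta V₁) (y₃ := V₃ - theta V₄)
    (y₄ := V₄ - theta V₃) (by rw [map_smul, adA31_apply, Ring.lie_def, sub_self, smul_zero])
    (by rw [map_add, l1, m2]; module) (by rw [map_add, l2, m1]; module)
    (by rw [map_sub, l3, m4]; module) (by rw [map_sub, l4, m3]; module)
    (by linear_combination (norm := module) e2 - e1)
  have k0' : t • A31 = 0 := by linear_combination (norm := module) (1 / 2 : ℝ) • k0
  have d1 : IsDer (V₁ + V₂) := (isDer_of_mem_f4 v1.1).add (isDer_of_mem_f4 v2.1)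
  have d3 : IsDer (V₃ + V₄) := (isDer_of_mem_f4 v3.1).add (isDer_of_mem_f4 v4.1)
  have hD : D = Z + (V₁ + V₂) + (V₃ + V₄) := by
    rw [e1, k0']
    abel
  have h2 : V₂ = -theta V₁ := eq_neg_of_add_eq_zero_left k2
  have h4 : V₄ = theta V₃ := sub_eq_zero.1 k4
  have w1 := apply_E2_of_lie_lie_eq_self d1
    (by rw [theta_add, h2, ← neg_one_smul ℝ, theta_smul, theta_theta]; module)
    (by rw [← adA31_apply, ← adA31_apply, map_add, l1, l2, map_add, map_smul, map_smul, l1, l2]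
        module)
  have w3 := apply_E2_of_lie_lie_eq_four d3 (by rw [theta_add, h4, theta_theta, add_comm])
    (by rw [← adA31_apply, ← adA31_apply, map_add, l3, l4, map_add, map_smul, map_smul, l3, l4]
        module)
  rw [hD]
  refine ⟨((isDer_of_mem_f4 hZ.1).add d1).add d3, ?_⟩
  rw [add_apply, add_apply, mm_apply_E2 hZ, w1, w3, add_zero, add_zero]

theorem KEps_le_stabE2 : KEps ≤ stabE2 := by
  rintro _ ⟨k, hk, m, hm, rfl⟩
  refine mul_mem ((Subgroup.closure_le stabE2).2 ?_ hk) (M_le_stabE2 hm)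
  rintro g ⟨D, hD, hg⟩
  obtain ⟨h1, h2⟩ := kEps_isDer_and_apply_E2 hD
  exact exp_mem_stabE2 h1 h2 hg

/-! ### Elements of `M` -/

theorem octMul_mul_self_left {a : Oct ℝ} (ha : a 0 = 0) (ha1 : octInner a a = 1) (x : Oct ℝ) :
    octMul a (octMul a x) = -x := by
  have h := octMul_conj_mul a x
  rw [octConj_of_re_eq_zero ha, octMul_neg_left, ha1, one_smul] at h
  exact neg_eq_iff_eq_neg.1 h

theorem octMul_mul_self_right {a : Oct ℝ} (ha : a 0 = 0) (ha1 : octInner a a = 1) (x : Oct ℝ) :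
    octMul (octMul x a) a = -x := by
  have h := octMul_mul_conj x a
  rw [octConj_of_re_eq_zero ha, octMul_neg_right, ha1, one_smul] at h
  exact neg_eq_iff_eq_neg.1 h

/-- The linear map `h¹(ξ; x₁, x₂, x₃) ↦ h¹(ξ; -a x₁, x₂ a, -a x₃ a)`. -/
def trialityMap (a : Oct ℝ) : J1 →L[ℝ] J1 :=
  LinearMap.toContinuousLinearMap
    { toFun := fun X => h1 (X.1 0) (X.1 1) (X.1 2) (-octMul a (X.2 0)) (octMul (X.2 1) a)
        (-octMul (octMul a (X.2 2)) a)
      map_add' := by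
        intro X Y
        apply J1_ext <;> simp [octMul_add_left, octMul_add_right, add_comm]
      map_smul' := by
        intro c X
        apply J1_ext <;> simp [octMul_smul_left, octMul_smul_right] }

theorem trialityMap_apply (a : Oct ℝ) (X : J1) : trialityMap a X =
    h1 (X.1 0) (X.1 1) (X.1 2) (-octMul a (X.2 0)) (octMul (X.2 1) a)
      (-octMul (octMul a (X.2 2)) a) := rfl

theorem trialityMap_neg_apply {a : Oct ℝ} (ha : a 0 = 0) (ha1 : octInner a a = 1) (X : J1) :
    trialityMap (-a) (trialityMap a X) = X := by
  apply J1_ext <;> simp [trialityMap_apply, octMul_neg_left, octMul_neg_right,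
    octMul_mul_self_left ha ha1, octMul_mul_self_right ha ha1, octMul_flexible a]

/-- The triality automorphism attached to an imaginary unit. -/
def trialityGL (a : Oct ℝ) (ha : a 0 = 0) (ha1 : octInner a a = 1) : GLJ :=
  ContinuousLinearEquiv.equivOfInverse (trialityMap a) (trialityMap (-a))
    (trialityMap_neg_apply ha ha1)
    (fun X => by
      have h := trialityMap_neg_apply (a := -a) (by simp [ha])
        (by rw [octInner_neg_left, octInner_neg_right, neg_neg, ha1]) X
      rwa [neg_neg] at h)

theorem trialityGL_apply (a : Oct ℝ) (ha : a 0 = 0) (ha1 : octInner a a = 1) (X : J1) :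
    trialityGL a ha ha1 X = h1 (X.1 0) (X.1 1) (X.1 2) (-octMul a (X.2 0)) (octMul (X.2 1) a)
      (-octMul (octMul a (X.2 2)) a) := rfl

/-- The three Moufang identities give the three off-diagonal products; `a² = -1` removes the extra
factors. -/
theorem trialityGL_mem_F4 (a : Oct ℝ) (ha : a 0 = 0) (ha1 : octInner a a = 1) :
    trialityGL a ha ha1 ∈ F4 := by
  have p1 (x y : Oct ℝ) :
      octMul (octMul x a) (octMul (octMul a y) a) = -octMul (octMul x y) a := by
    rw [octMul_moufang_right, octMul_mul_self_right ha ha1, octMul_neg_left, octMul_neg_left]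
  have p2 (x y : Oct ℝ) :
      octMul (octMul (octMul a x) a) (octMul a y) = -octMul a (octMul x y) := by
    rw [octMul_moufang_left, octMul_mul_self_left ha ha1, octMul_neg_right, octMul_neg_right]
  have hc := octConj_of_re_eq_zero ha
  intro X Y
  apply J1_ext <;> simp only [trialityGL_apply, jordan, h1_fst_zero, h1_fst_one, h1_fst_two,
    h1_snd_zero, h1_snd_one, h1_snd_two, octInner_neg_left, octInner_neg_right, neg_neg,
    octInner_mul_left, octInner_mul_right, ha1, one_mul, octMul_neg_left, octMul_neg_right,
    p1, p2, octMul_moufang_middle]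
  all_goals simp only [octConj_neg, octConj_octMul _ a, octConj_octMul a, hc,
    octMul_add_left, octMul_add_right, octMul_sub_right, octMul_smul_left,
    octMul_smul_right, octMul_neg_left, octMul_neg_right, neg_neg, octMul_flexible]
  all_goals module

/-- Commuting with `Ã₃¹(1)` comes from `-a 1 a = 1` in the `x₃` slot and from conjugation exchanging
`-a x₁` with `x̄₁ a`. -/
theorem trialityGL_mem_M (a : Oct ℝ) (ha : a 0 = 0) (ha1 : octInner a a = 1) :
    trialityGL a ha ha1 ∈ M := by
  have hc := octConj_of_re_eq_zero ha
  refine ⟨⟨trialityGL_mem_F4 a ha ha1, Subgroup.mem_centralizer_iff.2 ?_⟩, ?_⟩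
  · rintro _ rfl
    refine ContinuousLinearEquiv.ext (funext fun X => ?_)
    change sigma (trialityGL a ha ha1 X) = trialityGL a ha ha1 (sigma X)
    apply J1_ext <;> simp [sigma_apply, trialityGL_apply, octMul_neg_left, octMul_neg_right]
  · have hcomm : ∀ X, trialityGL a ha ha1 (A31 X) = A31 (trialityGL a ha ha1 X) := by
      intro X
      have h0 : octMul (octMul a (X.2 2)) a 0 = -(X.2 2 0) := by
        have h := octMul_apply_zero (octMul a (X.2 2)) a
        rw [hc, octInner_neg_right] at h
        have h2 := octInner_mul_left a (X.2 2) octOne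
        rw [octMul_one, ha1, one_mul, octInner_comm _ octOne, octInner_one_left] at h2
        rw [h, h2]
      have h1 : octMul a a = -octOne := by
        simpa [octMul_one] using octMul_mul_self_left ha ha1 octOne
      apply J1_ext <;> simp [A31_apply, trialityGL_apply, octInner_one_left, h0, octConj_neg,
        octConj_octMul, hc, octMul_neg_left, octMul_neg_right, octMul_smul_left,
        octMul_smul_right, octMul_one, h1]
    refine ContinuousLinearMap.ext fun X => ?_
    change trialityGL a ha ha1 (A31 (((trialityGL a ha ha1)⁻¹ : GLJ) X)) = A31 X
    rw [hcomm]
    exact congrArg A31 ((trialityGL a ha ha1).apply_symm_apply X)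

theorem M_le_KEps {m : GLJ} (hm : m ∈ M) : m ∈ KEps := ⟨1, one_mem _, m, hm, (one_mul m).symm⟩

/-! ### Elements of `𝔨_ε` -/

theorem isDer_zero : IsDer 0 := by
  intro X Y
  have h0 (Z : J1) : jordan 0 Z = 0 := by simpa using jordan_smul_left 0 0 Z
  simp [h0, jordan_comm X]

theorem IsDer.mem_rootSpace {V : J1 →L[ℝ] J1} (h : IsDer V) {c : ℤ}
    (hA : adA31 V = (c : ℝ) • V) : V ∈ rootSpace c := by
  refine ⟨h.mem_f4, fun t => ?_⟩
  have : ⁅t • A31, V⁆ = t • adA31 V := by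
    rw [adA31_apply, Ring.lie_def, Ring.lie_def, smul_sub, smul_mul_assoc, mul_smul_comm]
  rw [this, hA, smul_smul, mul_comm]

theorem mem_kEps_of_rootSpace {V : ℤ → (J1 →L[ℝ] J1)} (hV : ∀ c ∈ roots, V c ∈ rootSpace c)
    (h1 : V (-1) = -theta (V 1)) (h2 : V (-2) = theta (V 2)) :
    V 1 + V (-1) + V 2 + V (-2) ∈ kEps := by
  have hs (W : ℤ → (J1 →L[ℝ] J1)) : ∑ c ∈ roots, W c = W 1 + W (-1) + W 2 + W (-2) := by
    simp [roots, add_assoc]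
  have e1 : eps 1 = -1 := by simp [eps]
  have e2 : eps (-1) = -1 := by simp [eps]
  have e3 : eps 2 = 1 := by norm_num [eps]
  have e4 : eps (-2) = 1 := by norm_num [eps]
  have ht : theta 0 = 0 := by simp [theta, Ad]
  have hA : theta ((0 : J1 →L[ℝ] J1) + 0) = 0 := by rw [add_zero, ht]
  refine ⟨0, ⟨0, (zero_smul ℝ A31).symm⟩, 0, ⟨isDer_zero.mem_f4, ht, ?_⟩, V, hV, ?_, ?_⟩
  · rw [Ring.lie_def, zero_mul, mul_zero, sub_zero]
  · rw [hs, add_zero, zero_add]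
  · rw [hs, hA, zero_add, e1, e2, e3, e4, h1, h2, ← neg_one_smul ℝ, theta_smul, theta_theta,
      theta_theta]
    module

theorem theta_adA31 (D : J1 →L[ℝ] J1) : theta (adA31 D) = -adA31 (theta D) := theta_lie_A31 D

theorem IsDer.adA31 {D : J1 →L[ℝ] J1} (h : IsDer D) : IsDer (adA31 D) := isDer_A31.lie h

/-- The root components are the spectral projections `W/2 ± (ad W)/4`, of eigenvalues `±2`, which
`θ` exchanges. -/
theorem IsDer.mem_kEps_of_eq_four {W : J1 →L[ℝ] J1} (h : IsDer W) (ht : theta W = W)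
    (hA : F4Minus20.adA31 (F4Minus20.adA31 W) = (4 : ℝ) • W) : W ∈ kEps := by
  have key := mem_kEps_of_rootSpace (V := fun c => if c = 2 then
    (1 / 2 : ℝ) • W + (1 / 4 : ℝ) • F4Minus20.adA31 W else if c = -2 then
    (1 / 2 : ℝ) • W + (-1 / 4 : ℝ) • F4Minus20.adA31 W else 0) ?_ ?_ ?_
  · norm_num at key
    convert key using 1
    module
  · intro c hc
    simp only [roots, Finset.mem_insert, Finset.mem_singleton] at hc
    rcases hc with rfl | rfl | rfl | rfl
    · exact isDer_zero.mem_rootSpace (by simp)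
    · exact isDer_zero.mem_rootSpace (by simp)
    · refine ((h.smul _).add (h.adA31.smul _)).mem_rootSpace ?_
      rw [map_add, map_smul, map_smul, hA]
      push_cast
      module
    · refine ((h.smul _).add (h.adA31.smul _)).mem_rootSpace ?_
      rw [map_add, map_smul, map_smul, hA]
      push_cast
      module
  · norm_num [theta, Ad]
  · norm_num only [if_true, if_false]
    rw [theta_add, theta_smul, theta_smul, theta_adA31, ht]
    module

/-- The components are `(W ± ad W)/2`. The sign `ε(±α) = -1` is what admits `θ`-odd, hence
noncompact, directions. -/
theorem IsDer.mem_kEps_of_eq_self {W : J1 →L[ℝ] J1} (h : IsDer W) (ht : theta W = -W)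
    (hA : F4Minus20.adA31 (F4Minus20.adA31 W) = W) : W ∈ kEps := by
  have key := mem_kEps_of_rootSpace (V := fun c => if c = 1 then
    (1 / 2 : ℝ) • W + (1 / 2 : ℝ) • F4Minus20.adA31 W else if c = -1 then
    (1 / 2 : ℝ) • W + (-1 / 2 : ℝ) • F4Minus20.adA31 W else 0) ?_ ?_ ?_
  · norm_num at key
    convert key using 1
    module
  · intro c hc
    simp only [roots, Finset.mem_insert, Finset.mem_singleton] at hc
    rcases hc with rfl | rfl | rfl | rfl
    · refine ((h.smul _).add (h.adA31.smul _)).mem_rootSpace ?_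
      rw [map_add, map_smul, map_smul, hA]
      push_cast
      module
    · refine ((h.smul _).add (h.adA31.smul _)).mem_rootSpace ?_
      rw [map_add, map_smul, map_smul, hA]
      push_cast
      module
    · exact isDer_zero.mem_rootSpace (by simp)
    · exact isDer_zero.mem_rootSpace (by simp)
  · norm_num only [if_true, if_false]
    rw [theta_add, theta_smul, theta_smul, theta_adA31, ht, map_neg]
    module
  · norm_num [theta, Ad]

theorem exp_mem_KEps {D : J1 →L[ℝ] J1} (h : D ∈ kEps) : expGL D ∈ KEps :=
  ⟨expGL D, Subgroup.subset_closure ⟨D, h, rfl⟩, 1, one_mem _, (mul_one _).symm⟩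

/-! ### Explicit derivations in `𝔨_ε`: rotations from `±2α` and a boost from `±α` -/

theorem octMul_alternative_right (x a y : Oct ℝ) :
    octMul x (octMul a y + octMul y a) = octMul (octMul x y) a + octMul (octMul x a) y := by
  funext i
  fin_cases i <;> simp [octMul_eq] <;> ring

theorem octMul_alternative_left (a x y : Oct ℝ) :
    octMul (octMul a x + octMul x a) y = octMul a (octMul x y) + octMul x (octMul a y) := by
  funext i
  fin_cases i <;> simp [octMul_eq] <;> ring

/-- Cyclic invariance of the associator, in the form `[a, x, y] = [x, y, a]`. -/
theorem octMul_alternative_cyclic (a x y : Oct ℝ) :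
    octMul (octMul a x) y =
      octMul a (octMul x y) + octMul (octMul x y) a - octMul x (octMul y a) := by
  funext i
  fin_cases i <;> simp [octMul_eq] <;> ring

theorem octInner_mul_left_self (a x : Oct ℝ) : octInner (octMul a x) x = a 0 * octInner x x := by
  have h := octInner_mul_right x a octOne
  rwa [one_octMul, octInner_comm a, octInner_one_left, mul_comm] at h

theorem octInner_mul_right_self (a x : Oct ℝ) : octInner (octMul x a) x = a 0 * octInner x x := by
  have h := octInner_mul_left x a octOne
  rwa [octMul_one, octInner_comm a, octInner_one_left, mul_comm] at h

theorem octMul_add_octMul_comm {a : Oct ℝ} (ha : a 0 = 0) (x : Oct ℝ) :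
    octMul a x + octMul x a = (2 * x 0) • a - (2 * octInner a x) • octOne := by
  rw [octInner_eq_sum, octOne_eq, octMul_eq, octMul_eq]
  funext i
  fin_cases i <;> simp [ha, Fin.sum_univ_eight] <;> ring

/-- The derivation `h¹(ξ; x₁, x₂, x₃) ↦ h¹(0; -a x₁, -x₂ a, a x₃ + x₃ a)`. -/
def rotationDer (a : Oct ℝ) : J1 →L[ℝ] J1 :=
  LinearMap.toContinuousLinearMap
    { toFun := fun X => h1 0 0 0 (-octMul a (X.2 0)) (-octMul (X.2 1) a)
        (octMul a (X.2 2) + octMul (X.2 2) a)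
      map_add' := by
        intro X Y
        apply J1_ext <;> simp [octMul_add_left, octMul_add_right, add_comm]
        abel
      map_smul' := by
        intro c X
        apply J1_ext <;> simp [octMul_smul_left, octMul_smul_right] }

theorem rotationDer_apply (a : Oct ℝ) (X : J1) : rotationDer a X =
    h1 0 0 0 (-octMul a (X.2 0)) (-octMul (X.2 1) a) (octMul a (X.2 2) + octMul (X.2 2) a) := rfl

theorem isDer_rotationDer {a : Oct ℝ} (ha : a 0 = 0) : IsDer (rotationDer a) := by
  have hc := octConj_of_re_eq_zero ha
  refine isDer_of_self fun X => ?_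
  apply J1_ext <;> simp only [rotationDer_apply, jordan, h1_fst_zero, h1_fst_one, h1_fst_two,
    h1_snd_zero, h1_snd_one, h1_snd_two, Prod.smul_fst, Prod.smul_snd, Pi.smul_apply, smul_eq_mul,
    octMul_alternative_left, octMul_alternative_right, octMul_neg_left, octMul_neg_right,
    octInner_neg_left, octInner_add_left, octInner_mul_left_self, octInner_mul_right_self, ha,
    octMul_smul_left, octMul_smul_right, octMul_alternative_cyclic a (X.2 0) (X.2 1)]
  · ring
  · ring
  · ring
  all_goals simp only [octConj_neg, octConj_octMul _ a, octConj_octMul a, hc, octConj_add,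
    octConj_sub, octMul_add_left, octMul_add_right, octMul_sub_right, octMul_smul_left, octMul_smul_right, octMul_neg_left, octMul_neg_right]
  all_goals module

theorem theta_rotationDer (a : Oct ℝ) : theta (rotationDer a) = rotationDer a := by
  refine ContinuousLinearMap.ext fun X => ?_
  rw [theta_apply]
  apply J1_ext <;> simp [sigma_apply, rotationDer_apply, octMul_neg_left, octMul_neg_right]
  abel

theorem adA31_rotationDer {a : Oct ℝ} (ha : a 0 = 0) (X : J1) : adA31 (rotationDer a) X =
    h1 (4 * octInner a (X.2 2)) (-4 * octInner a (X.2 2)) 0 ((2 : ℝ) • octMul a (octConj (X.2 1)))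
      ((2 : ℝ) • octMul (octConj (X.2 0)) a) ((-2 * (X.1 1 - X.1 0)) • a) := by
  have hc := octConj_of_re_eq_zero ha
  rw [adA31_apply, lie_apply_apply]
  apply J1_ext <;> simp only [Prod.fst_sub, Prod.snd_sub, Pi.sub_apply, rotationDer_apply,
    A31_apply, octMul_add_octMul_comm ha, octInner_one_left, h1_fst_zero, h1_fst_one, h1_fst_two,
    h1_snd_zero, h1_snd_one, h1_snd_two, octConj_neg, octConj_octMul, hc, octMul_neg_left,
    octMul_neg_right]
  · simp [ha, octOne_zero]; ring
  · simp [ha, octOne_zero]; ring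
  · simp
  · module
  · module
  · simp only [Pi.smul_apply, octOne_zero, octInner_smul_right, octInner_comm a octOne,
      octInner_one_left, ha, smul_eq_mul]
    module

theorem adA31_adA31_rotationDer {a : Oct ℝ} (ha : a 0 = 0) :
    adA31 (adA31 (rotationDer a)) = (4 : ℝ) • rotationDer a := by
  have hc := octConj_of_re_eq_zero ha
  refine ContinuousLinearMap.ext fun X => ?_
  rw [adA31_apply, lie_apply_apply, adA31_rotationDer ha, adA31_rotationDer ha]
  apply J1_ext <;> simp only [Prod.fst_sub, Prod.snd_sub, Pi.sub_apply, rotationDer_apply,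
    A31_apply, octMul_add_octMul_comm ha, octInner_one_left, h1_fst_zero, h1_fst_one, h1_fst_two,
    h1_snd_zero, h1_snd_one, h1_snd_two, octConj_smul, octConj_octMul, hc, octMul_neg_left,
    octMul_neg_right, octConj_octConj, smul_apply, Prod.smul_fst, Prod.smul_snd, Pi.smul_apply,
    octInner_smul_right, octInner_comm a octOne, ha, smul_eq_mul]
  · ring
  · ring
  · ring
  all_goals module

/-- The derivation `h¹(ξ; x) ↦ h¹(-2 (1|x₂), 0, 2 (1|x₂); x̄₃, ξ₃ - ξ₁, x̄₁)`. -/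
def boostDer : J1 →L[ℝ] J1 :=
  LinearMap.toContinuousLinearMap
    { toFun := fun X => h1 (-2 * X.2 1 0) 0 (2 * X.2 1 0) (octConj (X.2 2))
        ((X.1 2 - X.1 0) • octOne) (octConj (X.2 0))
      map_add' := by
        intro X Y
        apply J1_ext <;> simp [octConj_add, mul_add]
        module
      map_smul' := by
        intro c X
        apply J1_ext <;> simp [octConj_smul, mul_left_comm, mul_sub, smul_smul] }

theorem boostDer_apply (X : J1) : boostDer X =
    h1 (-2 * X.2 1 0) 0 (2 * X.2 1 0) (octConj (X.2 2)) ((X.1 2 - X.1 0) • octOne)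
      (octConj (X.2 0)) := rfl

theorem isDer_boostDer : IsDer boostDer := by
  refine isDer_of_self fun X => ?_
  apply J1_ext <;> simp only [boostDer_apply, jordan, h1_fst_zero, h1_fst_one, h1_fst_two,
    h1_snd_zero, h1_snd_one, h1_snd_two, octInner_one_left, Prod.smul_fst, Prod.smul_snd,
    Pi.smul_apply, Pi.add_apply, smul_eq_mul, octMul_apply_zero, octInner_conj_left,
    octInner_smul_left, octInner_comm (X.2 2) (octConj (X.2 0)), octConj_add, octConj_sub,
    octConj_smul, octConj_octConj, octConj_octMul, octMul_smul_left, octMul_smul_right,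
    octMul_one, one_octMul, octMul_conj_self, octConj_mul_self, octConj_one]
  · ring
  · ring
  · ring
  · rw [octConj_eq_sub (X.2 1), octMul_sub_right, octMul_smul_right, octMul_one]
    module
  · module
  · rw [octConj_eq_sub (X.2 1), octMul_sub_left, octMul_smul_left, one_octMul]
    module

theorem theta_boostDer : theta boostDer = -boostDer := by
  refine ContinuousLinearMap.ext fun X => ?_
  rw [theta_apply, neg_apply]
  apply J1_ext <;> simp [sigma_apply, boostDer_apply, octConj_neg]

theorem octConj_apply_zero (x : Oct ℝ) : octConj x 0 = x 0 := by
  simp [octConj_eq]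

theorem adA31_boostDer (X : J1) : adA31 boostDer X =
    h1 0 (2 * X.2 0 0) (-2 * X.2 0 0) ((X.1 2 - X.1 1) • octOne) (-octConj (X.2 2))
      (octConj (X.2 1)) := by
  rw [adA31_apply, lie_apply_apply]
  apply J1_ext <;> simp only [Prod.fst_sub, Prod.snd_sub, Pi.sub_apply, boostDer_apply,
    A31_apply, octInner_one_left, h1_fst_zero, h1_fst_one, h1_fst_two, octConj_octConj,
    h1_snd_zero, h1_snd_one, h1_snd_two, octConj_smul, octConj_one, octConj_apply_zero]
  · ring
  · ring
  · ring
  · module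
  · rw [octConj_eq_sub]
    module
  · rw [octConj_eq_sub]
    module

theorem adA31_adA31_boostDer : adA31 (adA31 boostDer) = boostDer := by
  refine ContinuousLinearMap.ext fun X => ?_
  rw [adA31_apply, lie_apply_apply, adA31_boostDer, adA31_boostDer]
  apply J1_ext <;> simp only [Prod.fst_sub, Prod.snd_sub, Pi.sub_apply, boostDer_apply,
    A31_apply, octInner_one_left, h1_fst_zero, h1_fst_one, h1_fst_two, octConj_octConj,
    h1_snd_zero, h1_snd_one, h1_snd_two, octConj_smul, octConj_one, octConj_apply_zero,
    octConj_neg]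
  · ring
  · ring
  · ring
  · rw [octConj_eq_sub (X.2 2)]
    module
  · module
  · rw [octConj_eq_sub (X.2 0)]
    module

theorem rotationDer_mem_kEps {a : Oct ℝ} (ha : a 0 = 0) (t : ℝ) : t • rotationDer a ∈ kEps :=
  ((isDer_rotationDer ha).smul t).mem_kEps_of_eq_four (by rw [theta_smul, theta_rotationDer])
    (by rw [map_smul, map_smul, adA31_adA31_rotationDer ha, smul_comm])

theorem boostDer_mem_kEps (t : ℝ) : t • boostDer ∈ kEps :=
  (isDer_boostDer.smul t).mem_kEps_of_eq_self (by rw [theta_smul, theta_boostDer, smul_neg])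
    (by rw [map_smul, map_smul, adA31_adA31_boostDer])

/-! ### Orbits -/

theorem exp_apply_trig {D : J1 →L[ℝ] J1} {u v : J1} {k : ℝ} (hu : D u = k • v)
    (hv : D v = -(k • u)) (t : ℝ) :
    NormedSpace.exp (t • D) u = Real.cos (k * t) • u + Real.sin (k * t) • v := by
  have h := eq_exp_apply (D := D)
    (γ := fun s => Real.cos (k * s) • u + Real.sin (k * s) • v) (fun s => ?_) t
  · simpa using h.symm
  · have hk : HasDerivAt (fun s : ℝ => k * s) k s := by
      simpa using (hasDerivAt_id s).const_mul k
    refine ((hk.cos.smul_const u).add (hk.sin.smul_const v)).congr_deriv ?_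
    rw [map_add, map_smul, map_smul, hu, hv]
    module

theorem exp_apply_hyperbolic {D : J1 →L[ℝ] J1} {u v : J1} {k : ℝ} (hu : D u = k • v)
    (hv : D v = k • u) (t : ℝ) :
    NormedSpace.exp (t • D) u = Real.cosh (k * t) • u + Real.sinh (k * t) • v := by
  have h := eq_exp_apply (D := D)
    (γ := fun s => Real.cosh (k * s) • u + Real.sinh (k * s) • v) (fun s => ?_) t
  · simpa using h.symm
  · have hk : HasDerivAt (fun s : ℝ => k * s) k s := by
      simpa using (hasDerivAt_id s).const_mul k
    refine ((hk.cosh.smul_const u).add (hk.sinh.smul_const v)).congr_deriv ?_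
    rw [map_add, map_smul, map_smul, hu, hv]
    module

/-! ### Moving octonion entries to the nonnegative real axis -/

theorem exists_imaginary_unit_orthogonal (y : Oct ℝ) :
    ∃ b : Oct ℝ, b 0 = 0 ∧ octInner b b = 1 ∧ octInner b y = 0 := by
  -- The unit is sought in the plane of `e₁` and `e₂`, as the quarter turn of the projection of `y`
  -- when that is nonzero.
  by_cases h : y 1 = 0 ∧ y 2 = 0
  · refine ⟨![0, 1, 0, 0, 0, 0, 0, 0], rfl, ?_, ?_⟩ <;>
      simp [octInner_eq_sum, Fin.sum_univ_eight, h.1]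
  have hn : 0 < y 1 ^ 2 + y 2 ^ 2 := by
    rw [not_and_or] at h
    rcases h with h | h <;> positivity
  have hs := Real.mul_self_sqrt hn.le
  have hs0 := (Real.sqrt_pos.2 hn).ne'
  generalize Real.sqrt (y 1 ^ 2 + y 2 ^ 2) = s at hs hs0
  refine ⟨![0, y 2 / s, -(y 1 / s), 0, 0, 0, 0, 0], rfl, ?_, ?_⟩ <;>
    simp [octInner_eq_sum, Fin.sum_univ_eight] <;> field_simp
  · linarith
  · ring

theorem exists_eq_add_imaginary (x : Oct ℝ) :
    ∃ (a : Oct ℝ) (q : ℝ), a 0 = 0 ∧ octInner a a = 1 ∧ x = x 0 • octOne + q • a := by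
  set w := x - x 0 • octOne with hw
  have hw0 : w 0 = 0 := by simp [hw, octOne_zero]
  rcases eq_or_ne w 0 with h | h
  · obtain ⟨a, ha, ha1, -⟩ := exists_imaginary_unit_orthogonal 0
    exact ⟨a, 0, ha, ha1, by rw [zero_smul, add_zero, ← sub_eq_zero]; exact h⟩
  have hn : 0 < octInner w w :=
    lt_of_le_of_ne (octInner_self_nonneg w) (Ne.symm (octInner_self_eq_zero.not.2 h))
  have hs := Real.mul_self_sqrt hn.le
  have hs0 := (Real.sqrt_pos.2 hn).ne'
  generalize Real.sqrt (octInner w w) = s at hs hs0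
  refine ⟨s⁻¹ • w, s, by simp [hw0], ?_, ?_⟩
  · rw [octInner_smul_left, octInner_smul_right, ← hs]
    field_simp
  · rw [smul_inv_smul₀ hs0, hw]
    abel

/-- Choosing `b` orthogonal to `x̄` makes `bx` purely imaginary, say `bx = qa`; multiplying by `±a`
then gives a nonnegative real. -/
theorem exists_octMul_octMul_eq (x : Oct ℝ) : ∃ (a b : Oct ℝ) (r : ℝ),
    (a 0 = 0 ∧ octInner a a = 1) ∧ (b 0 = 0 ∧ octInner b b = 1) ∧ 0 ≤ r ∧
      octMul a (octMul b x) = r • octOne := by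
  obtain ⟨b, hb, hb1, hbx⟩ := exists_imaginary_unit_orthogonal (octConj x)
  obtain ⟨a, q, ha, ha1, hw⟩ := exists_eq_add_imaginary (octMul b x)
  rw [octMul_apply_zero, hbx, zero_smul, zero_add] at hw
  have haa : octMul a a = -octOne := by
    simpa [octMul_one] using octMul_mul_self_left ha ha1 octOne
  rcases le_total q 0 with hq | hq
  · refine ⟨a, b, -q, ⟨ha, ha1⟩, ⟨hb, hb1⟩, by linarith, ?_⟩
    rw [hw, octMul_smul_right, haa]
    module
  · refine ⟨-a, b, q, ⟨by simp [ha], by simp [octInner_neg_left, octInner_neg_right, ha1]⟩,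
      ⟨hb, hb1⟩, hq, ?_⟩
    rw [hw, octMul_smul_right, octMul_neg_left, haa, neg_neg]

theorem trialityGL_mem_KEps (a : Oct ℝ) (ha : a 0 = 0) (ha1 : octInner a a = 1) :
    trialityGL a ha ha1 ∈ KEps := M_le_KEps (trialityGL_mem_M a ha ha1)

/-- A triality element acts on a real `x₃` by `-a c a = c`, so `x₁` can be adjusted while `x₃` stays
put. -/
theorem exists_KEps_snd_zero (X : J1) (c : ℝ) (hX : X.2 2 = c • octOne) :
    ∃ g ∈ KEps, ∃ s : ℝ, 0 ≤ s ∧ (g X).2 0 = s • octOne ∧ (g X).2 2 = c • octOne := by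
  obtain ⟨a, b, r, ⟨ha, ha1⟩, ⟨hb, hb1⟩, hr, h⟩ := exists_octMul_octMul_eq (X.2 0)
  refine ⟨_, mul_mem (trialityGL_mem_KEps a ha ha1) (trialityGL_mem_KEps b hb hb1), r, hr, ?_⟩
  change (trialityGL a ha ha1 (trialityGL b hb hb1 X)).2 0 = _ ∧
    (trialityGL a ha ha1 (trialityGL b hb hb1 X)).2 2 = _
  have hb' : octMul b b = -octOne := by
    simpa [octMul_one] using octMul_mul_self_left hb hb1 octOne
  have ha' : octMul a a = -octOne := by
    simpa [octMul_one] using octMul_mul_self_left ha ha1 octOne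
  simp [trialityGL_apply, octMul_neg_right, h, hX, octMul_smul_right, octMul_smul_left,
    octMul_one, ha', hb']

theorem exists_KEps_snd_one (X : J1) : ∃ g ∈ KEps, ∃ s : ℝ, 0 ≤ s ∧ (g X).2 1 = s • octOne ∧
    ∀ i, (g X).1 i = X.1 i := by
  obtain ⟨a, b, r, ⟨ha, ha1⟩, ⟨hb, hb1⟩, hr, h⟩ := exists_octMul_octMul_eq (octConj (X.2 1))
  refine ⟨_, mul_mem (trialityGL_mem_KEps a ha ha1) (trialityGL_mem_KEps b hb hb1), r, hr, ?_, ?_⟩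
  · change octMul (octMul (X.2 1) b) a = _
    have h' := congrArg octConj h
    rw [octConj_octMul, octConj_octMul, octConj_octConj, octConj_of_re_eq_zero ha,
      octConj_of_re_eq_zero hb, octMul_neg_right, octMul_neg_right, octMul_neg_left, neg_neg,
      octConj_smul, octConj_one] at h'
    exact h'
  · intro i
    fin_cases i <;> rfl

theorem exists_KEps_snd_two (X : J1) :
    ∃ g ∈ KEps, ∃ c : ℝ, 0 ≤ c ∧ (g X).2 2 = c • octOne := by
  obtain ⟨a, q, ha, ha1, hx⟩ := exists_eq_add_imaginary (X.2 2)
  set p := X.2 2 0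
  let z : ℂ := ⟨p, q⟩
  have hp : p = ‖z‖ * Real.cos z.arg := (Complex.norm_mul_cos_arg z).symm
  have hq : q = ‖z‖ * Real.sin z.arg := (Complex.norm_mul_sin_arg z).symm
  have haa : octMul a a = -octOne := by
    simpa [octMul_one] using octMul_mul_self_left ha ha1 octOne
  -- With `x₃ = p + qa` read as the complex number `z`, the flow rotates `x₃` at speed `2` in the
  -- plane of `1` and `a`; half the argument, with opposite sign, makes it `‖z‖`.
  refine ⟨expGL ((-(z.arg / 2)) • rotationDer a), exp_mem_KEps (rotationDer_mem_kEps ha _),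
    ‖z‖, norm_nonneg z, ?_⟩
  change (NormedSpace.exp ((-(z.arg / 2)) • rotationDer a) X).2 2 = _
  have d1 : rotationDer a (h1 (X.1 0) (X.1 1) (X.1 2) 0 0 0) = 0 := by
    apply J1_ext <;> simp [rotationDer_apply, octMul_zero_left, octMul_zero_right]
  have d2 : rotationDer a (h1 0 0 0 (X.2 0) (X.2 1) 0) =
      (1 : ℝ) • h1 0 0 0 (-octMul a (X.2 0)) (-octMul (X.2 1) a) 0 := by
    apply J1_ext <;> simp [rotationDer_apply, octMul_zero_left, octMul_zero_right]
  have d3 : rotationDer a (h1 0 0 0 (-octMul a (X.2 0)) (-octMul (X.2 1) a) 0) =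
      -((1 : ℝ) • h1 0 0 0 (X.2 0) (X.2 1) 0) := by
    apply J1_ext <;> simp [rotationDer_apply, octMul_zero_left, octMul_zero_right,
      octMul_neg_left, octMul_neg_right, octMul_mul_self_left ha ha1,
      octMul_mul_self_right ha ha1]
  have d4 : rotationDer a (h1 0 0 0 0 0 octOne) = (2 : ℝ) • h1 0 0 0 0 0 a := by
    apply J1_ext <;> simp [rotationDer_apply, octMul_zero_left, octMul_zero_right, octMul_one,
      one_octMul, two_smul]
  have d5 : rotationDer a (h1 0 0 0 0 0 a) = -((2 : ℝ) • h1 0 0 0 0 0 octOne) := by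
    apply J1_ext <;> simp [rotationDer_apply, octMul_zero_left, octMul_zero_right, haa]
    module
  have d6 : rotationDer a (h1 0 0 0 0 0 a) = (2 : ℝ) • -h1 0 0 0 0 0 octOne := by
    rw [d5, smul_neg]
  have d7 : rotationDer a (-h1 0 0 0 0 0 octOne) = -((2 : ℝ) • h1 0 0 0 0 0 a) := by
    rw [map_neg, d4]
  have hX : X = h1 (X.1 0) (X.1 1) (X.1 2) 0 0 0 + h1 0 0 0 (X.2 0) (X.2 1) 0 +
      (p • h1 0 0 0 0 0 octOne + q • h1 0 0 0 0 0 a) := by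
    apply J1_ext <;> simp
    exact hx
  rw [hX, map_add, map_add, map_add, map_smul, map_smul, exp_apply_of_apply_eq_zero d1,
    exp_apply_trig d2 d3, exp_apply_trig d4 d5, exp_apply_trig d6 d7]
  have harg : 2 * -(z.arg / 2) = -z.arg := by ring
  rw [harg, Real.cos_neg, Real.sin_neg, hp, hq]
  have hcs := Real.sin_sq_add_cos_sq z.arg
  generalize Real.cos z.arg = C at *
  generalize Real.sin z.arg = S at *
  simp only [Prod.snd_add, Prod.smul_snd, Prod.snd_neg, Pi.add_apply, Pi.smul_apply,
    Pi.neg_apply, h1_snd_two, smul_zero, add_zero, zero_add]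
  have hn : ‖z‖ • (octOne : Oct ℝ) = (‖z‖ * (S ^ 2 + C ^ 2)) • octOne := by rw [hcs, mul_one]
  rw [hn]
  module

/-- `P12` splits into a vector killed by the boost and vectors in hyperbolic planes of speeds `2`
and `1`. -/
theorem exp_boostDer_P12 (t : ℝ) : NormedSpace.exp (t • boostDer) P12 =
    h1 (-Real.cosh t ^ 2) 1 (Real.sinh t ^ 2) (Real.sinh t • octOne)
      ((Real.cosh t * Real.sinh t) • octOne) (Real.cosh t • octOne) := by
  have d1 : boostDer (h1 (-1 / 2) 1 (-1 / 2) 0 0 0) = 0 := by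
    apply J1_ext <;> simp [boostDer_apply, octConj_zero]
  have d2 : boostDer (h1 1 0 (-1) 0 0 0) = (2 : ℝ) • h1 0 0 0 0 (-octOne) 0 := by
    apply J1_ext <;> simp [boostDer_apply, octConj_zero]
    module
  have d3 : boostDer (h1 0 0 0 0 (-octOne) 0) = (2 : ℝ) • h1 1 0 (-1) 0 0 0 := by
    apply J1_ext <;> simp [boostDer_apply, octConj_zero, octOne_zero]
  have d4 : boostDer (h1 0 0 0 0 0 octOne) = (1 : ℝ) • h1 0 0 0 octOne 0 0 := by
    apply J1_ext <;> simp [boostDer_apply, octConj_zero, octConj_one]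
  have d5 : boostDer (h1 0 0 0 octOne 0 0) = (1 : ℝ) • h1 0 0 0 0 0 octOne := by
    apply J1_ext <;> simp [boostDer_apply, octConj_zero, octConj_one]
  have hP : P12 = h1 (-1 / 2) 1 (-1 / 2) 0 0 0 + (-1 / 2 : ℝ) • h1 1 0 (-1) 0 0 0 +
      h1 0 0 0 0 0 octOne := by
    apply J1_ext <;> simp [P12]
  rw [hP, map_add, map_add, map_smul, exp_apply_of_apply_eq_zero d1,
    exp_apply_hyperbolic d2 d3, exp_apply_hyperbolic d4 d5, Real.cosh_two_mul,
    Real.sinh_two_mul, one_mul]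
  have hcs := Real.cosh_sq t
  apply J1_ext <;> simp
  · linarith
  · linarith
  · module

theorem smul_mem_N1minus {X : J1} (hX : X ∈ N1minus) {r : ℝ} (hr : 0 < r) : r • X ∈ N1minus := by
  rw [mem_N1minus_iff] at hX ⊢
  refine ⟨by rw [jordan_smul_left, jordan_smul_right, hX.1, smul_zero, smul_zero], ?_⟩
  exact mul_neg_of_pos_of_neg hr hX.2

theorem ray_smul (X : J1) {r : ℝ} (hr : 0 < r) : ray (r • X) = ray X :=
  (Quotient.sound ⟨r, hr, rfl⟩ : ray X = ray (r • X)).symm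

theorem KEps_mem_N1minus {g : GLJ} (hg : g ∈ KEps) {X : J1} (hX : X ∈ N1minus) :
    g X ∈ N1minus := ((KEps_le_stabE2 hg).2.2 X).2 hX

theorem KEps_fst_one {g : GLJ} (hg : g ∈ KEps) (X : J1) : (g X).1 1 = X.1 1 :=
  fst_one_of_fix (KEps_le_stabE2 hg).1 (KEps_le_stabE2 hg).2.1 X

theorem exists_KEps_eq_P12 {X : J1} (hX : X ∈ N1minus) (h : X.1 1 = 1) :
    ∃ g ∈ KEps, g X = P12 := by
  obtain ⟨g, hg, c, hc, hgX⟩ := exists_KEps_snd_two X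
  obtain ⟨k, hk, s, hs, hk0, hk2⟩ := exists_KEps_snd_zero (g X) c hgX
  have hN := KEps_mem_N1minus hk (KEps_mem_N1minus hg hX)
  have h1' : (k (g X)).1 1 = 1 := by rw [KEps_fst_one hk, KEps_fst_one hg, h]
  obtain ⟨r1, -, r3, r4, r5⟩ := N1minus_relations hN
  have hone : octInner (octOne : Oct ℝ) octOne = 1 := octInner_one_left octOne
  rw [hk2, octInner_smul_left, octInner_smul_right, hone, h1'] at r1
  rw [hk0, octInner_smul_left, octInner_smul_right, hone, h1'] at r3
  rw [hk0, hk2, h1', octMul_smul_left, one_octMul, octConj_smul, octConj_smul, octConj_one] at r5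
  have hsinh := Real.sinh_arsinh s
  -- The null relations at `ξ₂ = 1` give `ξ₁ = -c²` and `ξ₃ = s²`, so the vanishing trace says `c² =
  -- 1 + s²`.
  have hcosh : Real.cosh (Real.arsinh s) = c := by
    rw [← pow_left_inj₀ (Real.cosh_pos _).le hc two_ne_zero, Real.cosh_sq, hsinh]
    linarith
  have hZ : k (g X) = expGL (Real.arsinh s • boostDer) P12 := by
    change _ = NormedSpace.exp (Real.arsinh s • boostDer) P12
    rw [exp_boostDer_P12, hsinh, hcosh]
    refine J1_ext ?_ h1' ?_ hk0 ?_ hk2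
    · rw [h1_fst_zero]
      linarith
    · rw [h1_fst_two]
      linarith
    · rw [h1_snd_one, mul_smul, ← r5, one_smul]
  have he := exp_mem_KEps (boostDer_mem_kEps (Real.arsinh s))
  refine ⟨(expGL (Real.arsinh s • boostDer))⁻¹ * (k * g),
    mul_mem (inv_mem he) (mul_mem hk hg), ?_⟩
  change (expGL (Real.arsinh s • boostDer))⁻¹ (k (g X)) = P12
  rw [hZ]
  exact ContinuousLinearEquiv.symm_apply_apply _ _

theorem exists_KEps_eq_P13 {X : J1} (hX : X ∈ N1minus) (h : X.1 1 = 0) (h0 : X.1 0 = -1) :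
    ∃ g ∈ KEps, g X = P13 := by
  obtain ⟨g, hg, s, hs, hgX, hd⟩ := exists_KEps_snd_one X
  refine ⟨g, hg, ?_⟩
  obtain ⟨r1, r2, r3, r4, -⟩ := N1minus_relations (KEps_mem_N1minus hg hX)
  have hone : octInner (octOne : Oct ℝ) octOne = 1 := octInner_one_left octOne
  rw [hd 0, hd 1, h, h0] at r4
  rw [hd 1, h, mul_zero, zero_eq_neg] at r1
  rw [hd 1, h, zero_mul] at r3
  have h2 : X.1 2 = 1 := by linarith [hd 2]
  rw [hd 0, hd 2, h0, h2, hgX, octInner_smul_left, octInner_smul_right, hone] at r2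
  have hs1 : s = 1 := by nlinarith
  refine J1_ext ?_ ?_ ?_ ?_ ?_ ?_
  · rw [hd, h0]; rfl
  · rw [hd, h]; rfl
  · rw [hd, h2]; rfl
  · rw [octInner_self_eq_zero.1 r3.symm]; rfl
  · rw [hgX, hs1, one_smul]; rfl
  · rw [octInner_self_eq_zero.1 r1]; rfl

/-! ### Base points and orbits of rays -/

theorem P12_mem_N1minus : P12 ∈ N1minus := by
  rw [mem_N1minus_iff]
  refine ⟨?_, by simp [P12]⟩
  have hone : octInner (octOne : Oct ℝ) octOne = 1 := octInner_one_left octOne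
  apply J1_ext <;> simp [jordan, P12, octInner_zero_left, octMul_zero_left, octMul_zero_right,
    octConj_zero, hone]

theorem P13_mem_N1minus : P13 ∈ N1minus := by
  rw [mem_N1minus_iff]
  refine ⟨?_, by simp [P13]⟩
  have hone : octInner (octOne : Oct ℝ) octOne = 1 := octInner_one_left octOne
  apply J1_ext <;> simp [jordan, P13, octInner_zero_left, octMul_zero_left, octMul_zero_right,
    octConj_zero, hone]

theorem ray_mem_orbit {g : GLJ} (hg : g ∈ KEps) {X P : J1} (h : g X = P) :
    ray X ∈ MulAction.orbit KEps (ray P) := by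
  refine ⟨(⟨g, hg⟩ : KEps)⁻¹, ?_⟩
  change (g⁻¹ : GLJ) • ray P = ray X
  rw [inv_smul_eq_iff, smul_ray, h]

theorem ray_mem_orbit_P12 {X : J1} (hX : X ∈ N1minus) (h : 0 < X.1 1) :
    ray X ∈ MulAction.orbit KEps (ray P12) := by
  -- The ray is represented by its point with `ξ₂ = 1`.
  obtain ⟨g, hg, hgX⟩ := exists_KEps_eq_P12 (smul_mem_N1minus hX (inv_pos.2 h))
    (inv_mul_cancel₀ h.ne')
  rw [← ray_smul X (inv_pos.2 h)]
  exact ray_mem_orbit hg hgX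

theorem ray_mem_orbit_P13 {X : J1} (hX : X ∈ N1minus) (h : X.1 1 = 0) :
    ray X ∈ MulAction.orbit KEps (ray P13) := by
  have h0 : 0 < -X.1 0 := neg_pos.2 (mem_N1minus_iff.1 hX).2
  -- Since `ξ₂ = 0`, the representative is normalized by `ξ₁ = -1` instead.
  obtain ⟨g, hg, hgX⟩ := exists_KEps_eq_P13 (smul_mem_N1minus hX (inv_pos.2 h0))
    (by simp [h]) (by
      change (-X.1 0)⁻¹ * X.1 0 = -1
      rw [inv_neg, neg_mul, inv_mul_cancel₀ (neg_pos.1 h0).ne])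
  rw [← ray_smul X (inv_pos.2 h0)]
  exact ray_mem_orbit hg hgX

theorem orbit_P12_eq :
    MulAction.orbit KEps (ray P12) = {q | ∃ X ∈ N1minus, q = ray X ∧ 0 < inn X E2} := by
  ext q
  constructor
  · rintro ⟨g, rfl⟩
    refine ⟨(g : GLJ) P12, KEps_mem_N1minus g.2 P12_mem_N1minus, rfl, ?_⟩
    rw [inn_E2_right, KEps_fst_one g.2]
    exact one_pos
  · rintro ⟨X, hX, rfl, h⟩
    rw [inn_E2_right] at h
    exact ray_mem_orbit_P12 hX h

theorem orbit_P13_eq :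
    MulAction.orbit KEps (ray P13) = {q | ∃ X ∈ N1minus, q = ray X ∧ inn X E2 = 0} := by
  ext q
  constructor
  · rintro ⟨g, rfl⟩
    refine ⟨(g : GLJ) P13, KEps_mem_N1minus g.2 P13_mem_N1minus, rfl, ?_⟩
    rw [inn_E2_right, KEps_fst_one g.2]
    rfl
  · rintro ⟨X, hX, rfl, h⟩
    rw [inn_E2_right] at h
    exact ray_mem_orbit_P13 hX h

end F4Minus20

end

open F4Minus20 in
theorem theorem9p7 :
    FF = MulAction.orbit KEps (ray P12) ∪ MulAction.orbit KEps (ray P13) ∧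
    Disjoint (MulAction.orbit KEps (ray P12)) (MulAction.orbit KEps (ray P13)) ∧
    MulAction.orbit KEps (ray P12) = {q | ∃ X ∈ N1minus, q = ray X ∧ inn X E2 ≠ 0} ∧
    MulAction.orbit KEps (ray P12) = {q | ∃ X ∈ N1minus, q = ray X ∧ 0 < inn X E2} ∧
    MulAction.orbit KEps (ray P13) = {q | ∃ X ∈ N1minus, q = ray X ∧ inn X E2 = 0} := by
  have hnn : ∀ X ∈ N1minus, 0 ≤ inn X E2 := fun X hX => by
    rw [inn_E2_right]
    exact N1minus_fst_one_nonneg hX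
  refine ⟨?_, ?_, ?_, orbit_P12_eq, orbit_P13_eq⟩
  · rw [orbit_P12_eq, orbit_P13_eq]
    ext q
    constructor
    · rintro ⟨X, hX, rfl⟩
      rcases (hnn X hX).lt_or_eq with h | h
      · exact Or.inl ⟨X, hX, rfl, h⟩
      · exact Or.inr ⟨X, hX, rfl, h.symm⟩
    · rintro (⟨X, hX, rfl, -⟩ | ⟨X, hX, rfl, -⟩) <;> exact ⟨X, hX, rfl⟩
  · rw [orbit_P12_eq, orbit_P13_eq, Set.disjoint_left]
    rintro _ ⟨X, -, rfl, h⟩ ⟨Y, -, hXY, h'⟩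
    -- Representatives of one ray differ by a positive factor, so `ξ₂` cannot be positive at one and
    -- zero at the other.
    obtain ⟨r, hr0, rfl⟩ := Quotient.exact hXY
    rw [inn_E2_right] at h h'
    have : r * X.1 1 = 0 := h'
    rcases mul_eq_zero.1 this with hr | hr
    · exact hr0.ne' hr
    · exact h.ne' hr
  · rw [orbit_P12_eq]
    ext q
    constructor
    · rintro ⟨X, hX, rfl, h⟩
      exact ⟨X, hX, rfl, h.ne'⟩
    · rintro ⟨X, hX, rfl, h⟩
      exact ⟨X, hX, rfl, lt_of_le_of_ne (hnn X hX) (Ne.symm h)⟩
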